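/- For a vector $x$ of length $n$ with entries in a linearly ordered set let $\kappa(x)$ be the skew-symmetric $n\times n$ matrix with $\kappa_{kl}(x)=\sqrt{1/2}$, $0$ or $-\sqrt{1/2}$ according as $x_k>x_l$, $x_k=x_l$ or $x_k<x_l$, and define the Kemeny distance of two such vectors by $$\rho_\kappa(x,y)=\frac{n^2-n}{2}+\sum_{k,l=1}^{n}\kappa_{kl}(x)\,\kappa_{lk}(y).$$ Let $\mathcal M_n$ be the set of the $n^n-n$ non-constant vectors in $\{1,\dots,n\}^n$ (rankings of $n$ items with ties). For every $n\ge 2$ let $X_n,Y_n$ be independent random vectors, each uniformly distributed on $\mathcal M_n$, and let $D_n=\rho_\kappa(X_n,Y_n)$. Then: 1. for every $n\ge 2$, $E(D_n)=\frac{n^2-n}{2}$ and $\operatorname{Var}(D_n)>0$; 2. as $n\to\infty$, $\dfrac{D_n-E(D_n)}{\sqrt{\operatorname{Var}(D_n)}}\to N(0,1)$ in distribution, and likewise $\dfrac{D_n-\frac{n^2-n}{2}}{\dot\sigma_n}\to N(0,1)$ in distribution, where $\dot\sigma_n^2=\dfrac{(n-1)^2(n+4)(2n-1)}{18n}$; 3.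 the excess kurtosis $\gamma_n=\dfrac{E\big[(D_n-E(D_n))^4\big]}{\operatorname{Var}(D_n)^2}-3$ satisfies $\gamma_n<0$ and $\gamma_n<\gamma_{n+1}$ for every $n\ge2$, and $\gamma_n\to0$ as $n\to\infty$. -/

import Mathlib

open MeasureTheory ProbabilityTheory Filter Topology
open scoped Matrix

noncomputable section

/-- The score matrix `κ(x)` of a vector `x` with entries in a linear order (such as the extended
reals or the ranks `1, …, n`): `κ_{kl}(x)` is `√.5`, `0` or `-√.5` according as `x_k > x_l`,
`x_k = x_l` or `x_k < x_l`. -/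
def kemenyScore {α : Type*} [LinearOrder α] {n : ℕ} (x : Fin n → α) :
    Matrix (Fin n) (Fin n) ℝ :=
  Matrix.of fun k l => if x l < x k then √(1 / 2) else if x k < x l then -√(1 / 2) else 0

/-- The Kemeny distance
`ρ_κ(x, y) = (n² - n) / 2 + ∑_{k,l} (κ(x) ⊙ κ(y)ᵀ)_{kl}`. -/
def kemenyDist {α β : Type*} [LinearOrder α] [LinearOrder β] {n : ℕ}
    (x : Fin n → α) (y : Fin n → β) : ℝ :=
  ((n : ℝ) ^ 2 - n) / 2 + ∑ k, ∑ l, (kemenyScore x ⊙ (kemenyScore y)ᵀ) k l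

/-- The population `𝓜` of rankings with ties of `n` items: all vectors of length `n` over `n`
ordered values, except the `n` constant ones. -/
def kemenyPopulation (n : ℕ) : Set (Fin n → Fin n) :=
  {x | ∃ k l, x k ≠ x l}

/-- The normalising variance `(n - 1)² (n + 4) (2n - 1) / (18 n)` of the Kemeny distance. -/
def kemenyPopVariance (n : ℕ) : ℝ :=
  ((n : ℝ) - 1) ^ 2 * (n + 4) * (2 * n - 1) / (18 * n)

/-- The excess kurtosis of a real random variable: fourth central moment over squared variance,
minus `3`. -/
def excessKurtosis {Ω : Type*} [MeasurableSpace Ω] (Z : Ω → ℝ) (P : Measure Ω) : ℝ :=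
  centralMoment Z 4 P / variance Z P ^ 2 - 3

end

/-! Put C(x, y) = ∑ sgn(x_k - x_l) sgn(y_k - y_l), so that the distance is (n² - n)/2 - C/2
(`kemenyDist_eq`). C vanishes when x or y is constant, so removing the constant vectors only
reweights the uniform law on all vectors: E φ(C) = φ(0) + p⁻² (E₀ φ(C) - φ(0)), where p = 1 - n/nⁿ
and E₀ averages over all pairs of vectors (`integral_comp_concordance_eq_expect`). Under E₀ all
coordinates are independent.

Moments. Expanding C^r, and using that x and y are independent with the same law, E₀ C^r is a sum
over r ordered pairs of labels of the squared mean of a product of r signs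
(`expect_concordance_pow`). Read the pairs as the edges of a multigraph: the squared mean depends
only on the isomorphism type, and it is 0 if some edge is isolated. Two types remain for r = 2 and
fifteen for r = 4. Their multiplicities are counted by kernel computation and each mean reduces to
power sums, which gives `edgeSum_two` and `edgeSum_four`. The excess kurtosis is then p² K(n) - 3
with K rational; from n = 3 on, 0 < K < 3 and K increases, with limit 3, while p increases to 1. The
case n = 2 is a separate computation.

Normality. With g(a) = E_c sgn(a - c), the Hájek projection of C is 2(n - 1) ∑ g(x_j) g(y_j). It
misses C by at most 2n² in mean square (`expect_sq_concordance_sub_proj_le`), while the variance has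
order n³. The projection is a sum of independent terms, so its characteristic function is an n-th
power, whose limit follows from a second-order Taylor expansion (`tendsto_expect_exp_concordance`).
Lévy's continuity theorem concludes. -/

/-! ### Enumeration of edge sequences up to relabelling -/

/-- The pairs `(k, l)` with `k < l < v`. -/
def vertexPairs (v : ℕ) : List (ℕ × ℕ) :=
  (List.range v).flatMap fun l => (List.range l).map fun k => (k, l)

/-- The extensions of the edge sequence `L`, with labels below `v`, by `r` further edges, where
new vertices receive the next free labels. Each result records its number of vertices, a
multiplicity and the edge sequence. -/
def edgeExtensions : ℕ → ℕ → ℕ → List (ℕ × ℕ) → List (ℕ × ℕ × List (ℕ × ℕ))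
  | 0, v, w, L => [(v, w, L)]
  | r + 1, v, w, L =>
    -- The factor 2 counts both orientations of an edge that meets at most one new vertex. Two new
    -- vertices are chosen as an ordered pair in (n - v)(n - v - 1) ways, which already includes
    -- both orientations.
    (vertexPairs v).flatMap (fun e => edgeExtensions r v (2 * w) (e :: L)) ++
      ((List.range v).flatMap (fun k => edgeExtensions r (v + 1) (2 * w) ((k, v) :: L)) ++
        edgeExtensions r (v + 2) w ((v, v + 1) :: L))

/-- Two edges without a common vertex. -/
def edgesDisjoint (e f : ℕ × ℕ) : Bool :=
  e.1 != f.1 && e.1 != f.2 && e.2 != f.1 && e.2 != f.2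

/-- Some edge of `L` is disjoint from all the others. -/
def hasIsolatedEdge (L : List (ℕ × ℕ)) : Bool :=
  L.any fun e => (L.erase e).all (edgesDisjoint e)

/-- Record that the pattern vertex `i` is sent to `a`. -/
def assignVertex (lab : List ℕ) (i a : ℕ) : Option (List ℕ) :=
  if i < lab.length then (if lab.getD i 0 = a then some lab else none)
  else if a ∈ lab then none else some (lab ++ [a])

/-- Search for a labelling of the vertices of a pattern under which it becomes `L`. -/
def findLabelling : List (ℕ × ℕ) → List (ℕ × ℕ) → List ℕ → Option (List ℕ)
  | [], _, lab => some lab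
  | p :: ps, L, lab =>
    L.findSome? fun e => [e, e.swap].findSome? fun f =>
      ((assignVertex lab p.1 f.1).bind fun ext => assignVertex ext p.2 f.2).bind fun ext =>
        findLabelling ps (L.erase e) ext

/-- The edge with its end points in increasing order. -/
def orientEdge (e : ℕ × ℕ) : ℕ × ℕ := if e.1 ≤ e.2 then e else e.swap

/-- `lab` is an injective labelling of the `v` vertices of the pattern `p` by `0, …, v - 1` under
which `p` becomes `L`, up to the order and the orientation of the edges. -/
def isLabelling (v : ℕ) (L p : List (ℕ × ℕ)) (lab : List ℕ) : Bool :=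
  (List.range v).all (fun a => lab.contains a) && lab.length == v &&
    (p.map fun e => orientEdge (lab.getD e.1 0, lab.getD e.2 0)).isPerm L

/-- The edge sequence `L`, with `v` vertices, is a relabelling of the pattern `p`. -/
def matchesPattern (v : ℕ) (L p : List (ℕ × ℕ)) : Bool :=
  p.all (fun e => e.1 < v && e.2 < v) && p.any (fun e => e.2 + 1 == v) &&
    match findLabelling p L [] with
    | none => false
    | some lab => isLabelling v L p lab

/-- The index of the first pattern matching `L`, or the number of patterns. -/
def patternIndex (ps : List (List (ℕ × ℕ))) (v : ℕ) (L : List (ℕ × ℕ)) : ℕ :=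
  ps.findIdx (matchesPattern v L)

/-- Increase the weight of a key in an association list. -/
def addWeight (k : ℕ × ℕ) (w : ℕ) : List ((ℕ × ℕ) × ℕ) → List ((ℕ × ℕ) × ℕ)
  | [] => [(k, w)]
  | t :: ts => if t.1 = k then (k, t.2 + w) :: ts else t :: addWeight k w ts

/-- The total weights of the edge sequences, by number of vertices and pattern; sequences with an
isolated edge are dropped. -/
def patternTable (ps : List (List (ℕ × ℕ))) :
    List (ℕ × ℕ × List (ℕ × ℕ)) → List ((ℕ × ℕ) × ℕ)
  | [] => []
  | s :: ss =>
    if hasIsolatedEdge s.2.2 then patternTable ps ss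
    else addWeight (s.1, patternIndex ps s.1 s.2.2) s.2.1 (patternTable ps ss)

/-- The graphs with four edges and no isolated edge. -/
def fourEdgePatterns : List (List (ℕ × ℕ)) :=
  [[(0, 1), (0, 1), (0, 1), (0, 1)],
   [(0, 1), (0, 1), (0, 1), (0, 2)],
   [(0, 1), (0, 1), (0, 2), (0, 2)],
   [(0, 1), (0, 1), (0, 2), (1, 2)],
   [(0, 1), (0, 1), (0, 2), (0, 3)],
   [(0, 1), (0, 1), (0, 2), (1, 3)],
   [(0, 1), (0, 1), (0, 2), (2, 3)],
   [(0, 1), (0, 1), (2, 3), (2, 3)],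
   [(0, 1), (0, 2), (0, 3), (1, 2)],
   [(0, 1), (0, 2), (1, 3), (2, 3)],
   [(0, 1), (0, 1), (2, 3), (2, 4)],
   [(0, 1), (0, 2), (0, 3), (0, 4)],
   [(0, 1), (0, 2), (0, 3), (1, 4)],
   [(0, 1), (0, 2), (1, 3), (2, 4)],
   [(0, 1), (0, 2), (3, 4), (3, 5)]]

/-- The graphs with two edges and no isolated edge. -/
def twoEdgePatterns : List (List (ℕ × ℕ)) :=
  [[(0, 1), (0, 1)], [(0, 1), (0, 2)]]

/-! ### Means of sign products: relabelling, orientation and isolated edges -/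

open scoped BigOperators in
/-- Averages over functions depend only on the coordinates that are used. -/
theorem expect_comp_injective {κ ι β : Type*} [Fintype κ] [Fintype ι] [Fintype β] [Nonempty β]
    [DecidableEq κ] [DecidableEq ι] (f : ι → κ) (hf : Function.Injective f) (F : (ι → β) → ℝ) :
    𝔼 x : κ → β, F (x ∘ f) = 𝔼 y : ι → β, F y := by
  classical
  let e : (κ → β) ≃ (ι → β) × ({k // ¬ k ∈ Set.range f} → β) :=
    (Equiv.piEquivPiSubtypeProd (· ∈ Set.range f) fun _ => β).trans
      ((Equiv.arrowCongr (Equiv.ofInjective f hf).symm (Equiv.refl β)).prodCongr (Equiv.refl _))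
  have he : ∀ x, (e x).1 = x ∘ f := by
    intro x
    funext i
    simp [e, Equiv.arrowCongr, Equiv.piEquivPiSubtypeProd]
  rw [Fintype.expect_equiv e _ (fun z => F z.1) (fun x => by rw [he]), ← Finset.univ_product_univ,
    Finset.expect_product]
  simp

noncomputable section

/-- The sign of `a - b`, for elements of a linear order. -/
def ordSign {α : Type*} [LinearOrder α] (a b : α) : ℝ :=
  if b < a then 1 else if a < b then -1 else 0

theorem ordSign_self {α : Type*} [LinearOrder α] (a : α) : ordSign a a = 0 := by
  simp [ordSign]

theorem ordSign_swap {α : Type*} [LinearOrder α] (a b : α) : ordSign b a = -ordSign a b := by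
  unfold ordSign
  rcases lt_trichotomy a b with h | h | h
  · simp [h, h.not_gt]
  · simp [h]
  · simp [h, h.not_gt]

variable {n q : ℕ}

/-- The sign of `x_i - x_j` for labels `i, j < n`. -/
def edgeSign (x : Fin n → Fin q) (e : ℕ × ℕ) : ℝ :=
  if h : e.1 < n ∧ e.2 < n then ordSign (x ⟨e.1, h.1⟩) (x ⟨e.2, h.2⟩) else 0

theorem edgeSign_self (x : Fin n → Fin q) (k : ℕ) : edgeSign x (k, k) = 0 := by
  simp [edgeSign, ordSign_self]

theorem edgeSign_swap (x : Fin n → Fin q) (e : ℕ × ℕ) : edgeSign x e.swap = -edgeSign x e := by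
  unfold edgeSign
  by_cases h : e.1 < n ∧ e.2 < n
  · rw [dif_pos h, dif_pos (show e.swap.1 < n ∧ e.swap.2 < n from h.symm)]
    exact ordSign_swap _ _
  · rw [dif_neg h, dif_neg (show ¬(e.swap.1 < n ∧ e.swap.2 < n) from fun h' => h (And.symm h')),
      neg_zero]

/-- The product of the signs of the edges in a list. -/
def signProd (x : Fin n → Fin q) (L : List (ℕ × ℕ)) : ℝ := (L.map (edgeSign x)).prod

@[simp] theorem signProd_nil (x : Fin n → Fin q) : signProd x [] = 1 := rfl

@[simp] theorem signProd_cons (x : Fin n → Fin q) (e : ℕ × ℕ) (L : List (ℕ × ℕ)) :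
    signProd x (e :: L) = edgeSign x e * signProd x L := by
  simp [signProd]

theorem signProd_perm (x : Fin n → Fin q) {L L' : List (ℕ × ℕ)} (h : L.Perm L') :
    signProd x L = signProd x L' := (h.map _).prod_eq

open scoped BigOperators in
/-- The average of the product of the signs of the edges in a list. -/
def signMean (n q : ℕ) (L : List (ℕ × ℕ)) : ℝ := 𝔼 x : Fin n → Fin q, signProd x L

theorem signMean_perm {L L' : List (ℕ × ℕ)} (h : L.Perm L') : signMean n q L = signMean n q L' := by
  simp only [signMean, signProd_perm _ h]

theorem signMean_map [NeZero q] {p : ℕ} (f : ℕ → ℕ) (hf : Set.InjOn f (Set.Iio p))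
    (hfn : ∀ i < p, f i < n) (L : List (ℕ × ℕ)) (hL : ∀ e ∈ L, e.1 < p ∧ e.2 < p) :
    signMean n q (L.map (Prod.map f f)) = signMean p q L := by
  let g : Fin p → Fin n := fun i => ⟨f i, hfn i i.2⟩
  have hg : Function.Injective g := by
    intro i j h
    exact Fin.ext (hf i.2 j.2 (congrArg Fin.val h))
  rw [signMean, signMean, ← expect_comp_injective g hg]
  congr 1
  funext x
  unfold signProd
  rw [List.map_map]
  congr 1
  refine List.map_congr_left fun e he => ?_
  have h := hL e he
  have h' : (Prod.map f f e).1 < n ∧ (Prod.map f f e).2 < n := ⟨hfn _ h.1, hfn _ h.2⟩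
  simp only [Function.comp, edgeSign]
  rw [dif_pos h', dif_pos h]
  rfl

/-- Each reversed edge costs a factor -1 that does not depend on `x`. Hence `c` is chosen before
`x`, and it disappears once the mean is squared. -/
theorem signProd_map_orientEdge (L : List (ℕ × ℕ)) :
    ∃ c : ℝ, c ^ 2 = 1 ∧
      ∀ {n q : ℕ} (x : Fin n → Fin q), signProd x (L.map orientEdge) = c * signProd x L := by
  induction L with
  | nil => exact ⟨1, by norm_num, fun x => by simp⟩
  | cons e L ih =>
    obtain ⟨c, hc, h⟩ := ih
    by_cases he : e.1 ≤ e.2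
    · refine ⟨c, hc, fun x => ?_⟩
      simp only [List.map_cons, signProd_cons, h x, orientEdge, if_pos he]
      ring
    · refine ⟨-c, by simpa using hc, fun x => ?_⟩
      simp only [List.map_cons, signProd_cons, h x, orientEdge, if_neg he, edgeSign_swap]
      ring

theorem signMean_sq_congr {L L' : List (ℕ × ℕ)} {c : ℝ} (hc : c ^ 2 = 1)
    (h : ∀ x : Fin n → Fin q, signProd x L' = c * signProd x L) :
    signMean n q L' ^ 2 = signMean n q L ^ 2 := by
  simp only [signMean, h]
  rw [← Finset.mul_expect, mul_pow, hc, one_mul]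

/-- Transposing the two end points of the isolated edge preserves the mean and all other edges but
flips one sign, so the mean equals its own negative. -/
theorem signMean_eq_zero_of_hasIsolatedEdge [NeZero q] {L : List (ℕ × ℕ)}
    (hL : ∀ e ∈ L, e.1 < e.2 ∧ e.2 < n) (h : hasIsolatedEdge L = true) : signMean n q L = 0 := by
  obtain ⟨e, he, hd⟩ := List.any_eq_true.1 h
  have hp := List.perm_cons_erase he
  have hen := hL e he
  have hLn : ∀ f ∈ e :: L.erase e, f.1 < n ∧ f.2 < n := by
    intro f hf
    have := hL f (hp.mem_iff.2 hf)
    omega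
  let σ : ℕ → ℕ := Equiv.swap e.1 e.2
  have hσ : ∀ i < n, σ i < n := by
    intro i hi
    simp only [σ, Equiv.swap_apply_def]
    split_ifs <;> omega
  have hrest : (L.erase e).map (Prod.map σ σ) = L.erase e := by
    conv_rhs => rw [← List.map_id (L.erase e)]
    refine List.map_congr_left fun f hf => ?_
    have := List.all_eq_true.1 hd f hf
    simp only [edgesDisjoint, Bool.and_eq_true, bne_iff_ne, ne_eq] at this
    ext
    · exact Equiv.swap_apply_of_ne_of_ne (Ne.symm this.1.1.1) (Ne.symm this.1.2)
    · exact Equiv.swap_apply_of_ne_of_ne (Ne.symm this.1.1.2) (Ne.symm this.2)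
  have hcons : (e :: L.erase e).map (Prod.map σ σ) = e.swap :: L.erase e := by
    rw [List.map_cons, hrest]
    congr 1
    ext <;> simp [σ]
  have h1 := signMean_map (n := n) (q := q) σ ((Equiv.swap e.1 e.2).injective.injOn) hσ _ hLn
  rw [hcons] at h1
  have h2 : signMean n q (e.swap :: L.erase e) = -signMean n q (e :: L.erase e) := by
    simp only [signMean, signProd_cons, edgeSign_swap, neg_mul]
    exact Finset.expect_neg_distrib _ _
  rw [signMean_perm hp]
  linarith

/-- The sum, over all ways to add `r` ordered pairs of labels to `L`, of the squared mean of the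
sign product. -/
def edgeSum (n q : ℕ) : ℕ → List (ℕ × ℕ) → ℝ
  | 0, L => signMean n q L ^ 2
  | r + 1, L => ∑ k ∈ Finset.range n, ∑ l ∈ Finset.range n, edgeSum n q r ((k, l) :: L)

theorem edgeSum_congr {L L' : List (ℕ × ℕ)} {c : ℝ} (hc : c ^ 2 = 1)
    (h : ∀ x : Fin n → Fin q, signProd x L' = c * signProd x L) (r : ℕ) :
    edgeSum n q r L' = edgeSum n q r L := by
  induction r generalizing L L' with
  | zero => exact signMean_sq_congr hc h
  | succ r ih =>
    refine Finset.sum_congr rfl fun k _ => Finset.sum_congr rfl fun l _ => ih fun x => ?_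
    rw [signProd_cons, signProd_cons, h x]
    ring

theorem edgeSum_eq_zero {L : List (ℕ × ℕ)} (h : ∀ x : Fin n → Fin q, signProd x L = 0) (r : ℕ) :
    edgeSum n q r L = 0 := by
  induction r generalizing L with
  | zero => simp [edgeSum, signMean, h]
  | succ r ih =>
    refine Finset.sum_eq_zero fun k _ => Finset.sum_eq_zero fun l _ => ih fun x => ?_
    rw [signProd_cons, h x, mul_zero]

theorem edgeSum_cons_swap (k l : ℕ) (L : List (ℕ × ℕ)) (r : ℕ) :
    edgeSum n q r ((l, k) :: L) = edgeSum n q r ((k, l) :: L) := by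
  refine edgeSum_congr (c := -1) (by norm_num) (fun x => ?_) r
  rw [signProd_cons, signProd_cons, show (l, k) = (k, l).swap from rfl, edgeSign_swap]
  ring

theorem edgeSum_cons_self (k : ℕ) (L : List (ℕ × ℕ)) (r : ℕ) :
    edgeSum n q r ((k, k) :: L) = 0 :=
  edgeSum_eq_zero (fun x => by rw [signProd_cons, edgeSign_self, zero_mul]) r

theorem edgeSum_map [NeZero q] (σ : Equiv.Perm ℕ) (hσ : ∀ k, k < n ↔ σ k < n)
    (L : List (ℕ × ℕ)) (hL : ∀ e ∈ L, e.1 < n ∧ e.2 < n) (r : ℕ) :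
    edgeSum n q r (L.map (Prod.map σ σ)) = edgeSum n q r L := by
  induction r generalizing L with
  | zero =>
    simp only [edgeSum]
    rw [signMean_map σ σ.injective.injOn (fun i hi => (hσ i).1 hi) L hL]
  | succ r ih =>
    simp only [edgeSum]
    refine (Finset.sum_equiv σ (fun k => by simpa using hσ k) fun k hk =>
      Finset.sum_equiv σ (fun k => by simpa using hσ k) fun l hl => ?_).symm
    refine (ih ((k, l) :: L) ?_).symm
    intro e he
    rcases List.mem_cons.1 he with rfl | he
    · exact ⟨Finset.mem_range.1 hk, Finset.mem_range.1 hl⟩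
    · exact hL e he

/-- Labels from `v` on do not occur in `L`, so they are interchangeable for the next edge. -/
theorem edgeSum_map_swap [NeZero q] {v i j : ℕ} (hi : v ≤ i) (hj : v ≤ j) (hin : i < n)
    (hjn : j < n) (k l : ℕ) (hk : k < n) (hl : l < n) (L : List (ℕ × ℕ))
    (hL : ∀ e ∈ L, e.1 < v ∧ e.2 < v) (r : ℕ) :
    edgeSum n q r ((Equiv.swap i j k, Equiv.swap i j l) :: L) = edgeSum n q r ((k, l) :: L) := by
  have hmap : ((k, l) :: L).map (Prod.map (Equiv.swap i j) (Equiv.swap i j)) =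
      (Equiv.swap i j k, Equiv.swap i j l) :: L := by
    rw [List.map_cons]
    congr 1
    conv_rhs => rw [← List.map_id L]
    refine List.map_congr_left fun e he => ?_
    have := hL e he
    ext
    · exact Equiv.swap_apply_of_ne_of_ne (by omega) (by omega)
    · exact Equiv.swap_apply_of_ne_of_ne (by omega) (by omega)
  rw [← hmap]
  refine edgeSum_map _ (fun m => ?_) _ (fun e he => ?_) r
  · rw [Equiv.swap_apply_def]
    split_ifs <;> omega
  · rcases List.mem_cons.1 he with rfl | he
    · exact ⟨hk, hl⟩
    · have := hL e he
      omega

end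

/-! ### Splitting the sum over the next edge by how many fresh labels it uses -/

theorem sum_map_flatMap {α β : Type*} (l : List α) (f : α → List β) (g : β → ℝ) :
    ((l.flatMap f).map g).sum = (l.map fun a => ((f a).map g).sum).sum := by
  induction l with
  | nil => rfl
  | cons a l ih => simp [List.flatMap_cons, ih]

theorem sum_map_range_eq (v : ℕ) (f : ℕ → ℝ) :
    ((List.range v).map f).sum = ∑ k ∈ Finset.range v, f k := by
  induction v with
  | zero => simp
  | succ v ih => simp [List.range_succ, Finset.sum_range_succ, ih]

theorem vertexPairs_succ (v : ℕ) :
    vertexPairs (v + 1) = vertexPairs v ++ (List.range v).map fun k => (k, v) := by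
  simp [vertexPairs, List.range_succ, List.flatMap_append]

theorem mem_vertexPairs {v : ℕ} {e : ℕ × ℕ} (h : e ∈ vertexPairs v) : e.1 < e.2 ∧ e.2 < v := by
  obtain ⟨l, hl, hk⟩ := List.mem_flatMap.1 h
  obtain ⟨k, hkl, rfl⟩ := List.mem_map.1 hk
  exact ⟨List.mem_range.1 hkl, List.mem_range.1 hl⟩

theorem sum_range_sum_range_eq_vertexPairs (H : ℕ → ℕ → ℝ) (hsymm : ∀ k l, H l k = H k l)
    (hdiag : ∀ k, H k k = 0) (v : ℕ) :
    ∑ k ∈ Finset.range v, ∑ l ∈ Finset.range v, H k l =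
      2 * ((vertexPairs v).map fun e => H e.1 e.2).sum := by
  induction v with
  | zero => simp [vertexPairs]
  | succ v ih =>
    simp only [Finset.sum_range_succ, Finset.sum_add_distrib]
    rw [ih, vertexPairs_succ, List.map_append, List.sum_append, List.map_map, hdiag]
    simp only [Function.comp_def, hsymm _ v]
    rw [sum_map_range_eq]
    ring

/-- A double sum over `n` labels of which the last `n - v` are interchangeable. -/
theorem sum_pairs_interchangeable {n v : ℕ} (hv : v ≤ n) (H : ℕ → ℕ → ℝ)
    (hsymm : ∀ k l, H l k = H k l) (hdiag : ∀ k, H k k = 0)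
    (hone : ∀ k < v, ∀ l, v ≤ l → l < n → H k l = H k v)
    (htwo : ∀ k l, v ≤ k → k < n → v ≤ l → l < n → k ≠ l → H k l = H v (v + 1)) :
    ∑ k ∈ Finset.range n, ∑ l ∈ Finset.range n, H k l =
      2 * ((vertexPairs v).map fun e => H e.1 e.2).sum +
        2 * ((n : ℝ) - v) * ((List.range v).map fun k => H k v).sum +
        ((n : ℝ) - v) * ((n : ℝ) - v - 1) * H v (v + 1) := by
  obtain ⟨m, rfl⟩ := Nat.exists_eq_add_of_le hv
  simp only [Finset.sum_range_add, Finset.sum_add_distrib]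
  rw [sum_range_sum_range_eq_vertexPairs H hsymm hdiag, sum_map_range_eq]
  have h1 : ∑ k ∈ Finset.range v, ∑ j ∈ Finset.range m, H k (v + j) =
      m * ∑ k ∈ Finset.range v, H k v := by
    rw [Finset.mul_sum]
    refine Finset.sum_congr rfl fun k hk => ?_
    rw [Finset.sum_congr rfl fun j hj => hone k (Finset.mem_range.1 hk) (v + j) (by omega)
      (by have := Finset.mem_range.1 hj; omega)]
    simp
  have h2 : ∑ j ∈ Finset.range m, ∑ k ∈ Finset.range v, H (v + j) k =
      m * ∑ k ∈ Finset.range v, H k v := by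
    rw [← h1, Finset.sum_comm]
    exact Finset.sum_congr rfl fun k _ => Finset.sum_congr rfl fun j _ => hsymm _ _
  have h3 : ∑ j ∈ Finset.range m, ∑ i ∈ Finset.range m, H (v + j) (v + i) =
      m * ((m : ℝ) - 1) * H v (v + 1) := by
    have : ∀ j ∈ Finset.range m, ∑ i ∈ Finset.range m, H (v + j) (v + i) =
        ((m : ℝ) - 1) * H v (v + 1) := by
      intro j hj
      have hjm := Finset.mem_range.1 hj
      have hi : ∀ i ∈ Finset.range m, H (v + j) (v + i) =
          H v (v + 1) - if i = j then H v (v + 1) else 0 := by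
        intro i hi
        have him := Finset.mem_range.1 hi
        by_cases h : i = j
        · simp [h, hdiag]
        · rw [if_neg h, sub_zero]
          exact htwo _ _ (by omega) (by omega) (by omega) (by omega) (by omega)
      rw [Finset.sum_congr rfl hi, Finset.sum_sub_distrib, Finset.sum_ite_eq', if_pos hj]
      simp
      ring
    rw [Finset.sum_congr rfl this]
    simp
    ring
  rw [h1, h2, h3]
  push_cast
  ring

theorem cast_descFactorial_succ (n v : ℕ) :
    (n.descFactorial (v + 1) : ℝ) = ((n : ℝ) - v) * n.descFactorial v := by
  rw [Nat.descFactorial_succ]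
  rcases le_or_gt v n with h | h
  · push_cast [h]
    ring
  · simp [Nat.descFactorial_of_lt h]

section
variable {n q : ℕ}

theorem edgeSum_succ_eq [NeZero q] {v : ℕ} (hv : v ≤ n) (L : List (ℕ × ℕ))
    (hL : ∀ e ∈ L, e.1 < v ∧ e.2 < v) (r : ℕ) :
    edgeSum n q (r + 1) L =
      2 * ((vertexPairs v).map fun e => edgeSum n q r (e :: L)).sum +
        2 * ((n : ℝ) - v) * ((List.range v).map fun k => edgeSum n q r ((k, v) :: L)).sum +
        ((n : ℝ) - v) * ((n : ℝ) - v - 1) * edgeSum n q r ((v, v + 1) :: L) := by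
  refine sum_pairs_interchangeable hv (fun k l => edgeSum n q r ((k, l) :: L))
    (fun k l => edgeSum_cons_swap k l L r) (fun k => edgeSum_cons_self k L r) ?_ ?_
  · intro k hk l hvl hln
    have h := edgeSum_map_swap (q := q) hvl le_rfl hln (by omega) k l (by omega) hln L hL r
    rw [Equiv.swap_apply_left, Equiv.swap_apply_of_ne_of_ne (by omega) (by omega)] at h
    exact h.symm
  · intro k l hvk hkn hvl hln hkl
    -- Two transpositions carry (v, v + 1) to (k, l): `swap v k` gives (k, t), then `swap t l` gives
    -- (k, l).
    have ht : ∃ t, t ≠ k ∧ v ≤ t ∧ t < n ∧ t = Equiv.swap v k (v + 1) := by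
      refine ⟨_, ?_, ?_, ?_, rfl⟩ <;> rw [Equiv.swap_apply_def] <;> split_ifs <;> omega
    obtain ⟨t, htk, hvt, htn, ht⟩ := ht
    have h := edgeSum_map_swap (q := q) le_rfl hvk (by omega) hkn v (v + 1) (by omega) (by omega)
      L hL r
    rw [Equiv.swap_apply_left, ← ht] at h
    have h' := edgeSum_map_swap (q := q) hvt hvl htn hln k t hkn htn L hL r
    rw [Equiv.swap_apply_left, Equiv.swap_apply_of_ne_of_ne (Ne.symm htk) hkl] at h'
    exact h'.trans h

/-- The edge sum as a weighted sum over the extensions of `L` up to relabelling. -/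
theorem edgeSum_eq_sum_edgeExtensions [NeZero q] (r v w : ℕ) (L : List (ℕ × ℕ))
    (hL : ∀ e ∈ L, e.1 < v ∧ e.2 < v) :
    (w : ℝ) * n.descFactorial v * edgeSum n q r L =
      ((edgeExtensions r v w L).map fun s =>
        (s.2.1 : ℝ) * (n.descFactorial s.1 * signMean n q s.2.2 ^ 2)).sum := by
  induction r generalizing v w L with
  | zero => simp [edgeExtensions, edgeSum, mul_assoc]
  | succ r ih =>
    have hcons : ∀ (u : ℕ) (e : ℕ × ℕ), v ≤ u → e.1 < u ∧ e.2 < u →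
        ∀ f ∈ e :: L, f.1 < u ∧ f.2 < u := by
      intro u e hu he f hf
      rcases List.mem_cons.1 hf with rfl | hf
      · exact he
      · have := hL f hf
        omega
    rw [edgeExtensions, List.map_append, List.map_append, List.sum_append, List.sum_append,
      sum_map_flatMap, sum_map_flatMap,
      ← ih (v + 2) w ((v, v + 1) :: L) (hcons _ _ (by omega) (by simp)),
      List.map_congr_left fun e he => (ih v (2 * w) (e :: L) (hcons _ _ le_rfl
        (by have := mem_vertexPairs he; omega))).symm,
      List.map_congr_left fun k hk => (ih (v + 1) (2 * w) ((k, v) :: L) (hcons _ _ (by omega)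
        (by have := List.mem_range.1 hk; simp; omega))).symm]
    simp only [List.sum_map_mul_left]
    rw [cast_descFactorial_succ n (v + 1), cast_descFactorial_succ n v]
    rcases le_or_gt v n with h | h
    · rw [edgeSum_succ_eq h L hL r]
      push_cast
      ring
    -- With more vertices than labels every falling factorial is 0, so the identity needs no lower
    -- bound on `n`.
    · simp [Nat.descFactorial_of_lt h]

theorem edgeExtensions_spec {r v w : ℕ} {L : List (ℕ × ℕ)} (hL : ∀ e ∈ L, e.1 < e.2 ∧ e.2 < v)
    {s : ℕ × ℕ × List (ℕ × ℕ)} (hs : s ∈ edgeExtensions r v w L) :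
    ∀ e ∈ s.2.2, e.1 < e.2 ∧ e.2 < s.1 := by
  induction r generalizing v w L with
  | zero =>
    rw [edgeExtensions, List.mem_singleton] at hs
    subst hs
    exact hL
  | succ r ih =>
    have hcons : ∀ (u : ℕ) (e : ℕ × ℕ), v ≤ u → e.1 < e.2 ∧ e.2 < u →
        ∀ f ∈ e :: L, f.1 < f.2 ∧ f.2 < u := by
      intro u e hu he f hf
      rcases List.mem_cons.1 hf with rfl | hf
      · exact he
      · have := hL f hf
        omega
    rw [edgeExtensions, List.mem_append, List.mem_append, List.mem_flatMap, List.mem_flatMap] at hs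
    rcases hs with ⟨e, he, hs⟩ | ⟨k, hk, hs⟩ | hs
    · exact ih (hcons _ _ le_rfl (mem_vertexPairs he)) hs
    · exact ih (hcons _ _ (by omega) (by have := List.mem_range.1 hk; simp; omega)) hs
    · exact ih (hcons _ _ (by omega) (by simp)) hs

/-! ### Grouping by patterns -/

theorem sum_addWeight (F : ℕ × ℕ → ℝ) (k : ℕ × ℕ) (w : ℕ) (T : List ((ℕ × ℕ) × ℕ)) :
    ((addWeight k w T).map fun t => (t.2 : ℝ) * F t.1).sum =
      w * F k + (T.map fun t => (t.2 : ℝ) * F t.1).sum := by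
  induction T with
  | nil => simp [addWeight]
  | cons t T ih =>
    unfold addWeight
    split_ifs with h
    · subst h
      simp
      ring
    · simp [ih]
      ring

theorem keys_subset_addWeight (k : ℕ × ℕ) (w : ℕ) (T : List ((ℕ × ℕ) × ℕ)) :
    k ∈ (addWeight k w T).map Prod.fst ∧ ∀ a ∈ T.map Prod.fst, a ∈ (addWeight k w T).map Prod.fst := by
  induction T with
  | nil => simp [addWeight]
  | cons t T ih =>
    unfold addWeight
    split_ifs with h
    · subst h
      simp
    · obtain ⟨h1, h2⟩ := ih
      refine ⟨?_, ?_⟩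
      · rw [List.map_cons]
        exact List.mem_cons_of_mem _ h1
      · intro a ha
        rw [List.map_cons, List.mem_cons] at ha ⊢
        exact ha.imp id (h2 a)

theorem signMean_sq_of_isLabelling [NeZero q] {v : ℕ} {L p : List (ℕ × ℕ)} {lab : List ℕ}
    (hvn : v ≤ n) (hp : ∀ e ∈ p, e.1 < v ∧ e.2 < v) (h : isLabelling v L p lab = true) :
    signMean n q L ^ 2 = signMean v q p ^ 2 := by
  simp only [isLabelling, Bool.and_eq_true, List.all_eq_true, List.mem_range, beq_iff_eq,
    List.contains_iff_mem, List.isPerm_iff] at h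
  obtain ⟨⟨hsub, hlen⟩, hperm⟩ := h
  have hlab : (List.range v).Perm lab :=
    (List.nodup_range.subperm fun a ha => hsub a (List.mem_range.1 ha)).perm_of_length_le
      (by simp [hlen])
  have hnd : lab.Nodup := hlab.nodup_iff.1 List.nodup_range
  let f : ℕ → ℕ := fun i => lab.getD i 0
  have hget : ∀ i (hi : i < v), f i = lab[i]'(by omega) := fun i hi =>
    List.getD_eq_getElem _ _ (by omega)
  have hf : Set.InjOn f (Set.Iio v) := by
    intro i hi j hj hij
    rw [hget i hi, hget j hj] at hij
    exact (List.Nodup.getElem_inj_iff hnd).1 hij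
  have hfn : ∀ i < v, f i < n := by
    intro i hi
    rw [hget i hi]
    have := List.mem_range.1 (hlab.mem_iff.2 (List.getElem_mem (l := lab) (n := i) (by omega)))
    exact this.trans_le hvn
  have hmap : (p.map fun e => orientEdge (lab.getD e.1 0, lab.getD e.2 0)) =
      (p.map (Prod.map f f)).map orientEdge := by
    rw [List.map_map]
    rfl
  rw [← signMean_perm hperm, hmap]
  obtain ⟨c, hc, h⟩ := signProd_map_orientEdge (p.map (Prod.map f f))
  rw [signMean_sq_congr hc fun x => h x, signMean_map f hf hfn p hp]

theorem signMean_sq_of_matchesPattern [NeZero q] {v : ℕ} {L p : List (ℕ × ℕ)} (hvn : v ≤ n)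
    (h : matchesPattern v L p = true) : signMean n q L ^ 2 = signMean v q p ^ 2 := by
  rw [matchesPattern, Bool.and_eq_true, Bool.and_eq_true] at h
  -- The discarded conjunct, a comparison of vertex counts, only prunes the search.
  obtain ⟨⟨hp, -⟩, h⟩ := h
  cases hlab : findLabelling p L [] with
  | none => simp [hlab] at h
  | some lab =>
    rw [hlab] at h
    refine signMean_sq_of_isLabelling hvn (fun e he => ?_) h
    simpa using List.all_eq_true.1 hp e he

/-- No property of the search `findLabelling` is needed: each labelling it returns is rechecked by
`isLabelling`, and an unmatched sequence would get the index `ps.length`, which `hps` excludes. The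
mean of a pattern is taken over vectors of length equal to its vertex count, hence no longer
involves `n`. -/
theorem sum_eq_sum_patternTable [NeZero q] (ps : List (List (ℕ × ℕ)))
    (E : List (ℕ × ℕ × List (ℕ × ℕ))) (hE : ∀ s ∈ E, ∀ e ∈ s.2.2, e.1 < e.2 ∧ e.2 < s.1)
    (hps : ∀ k ∈ (patternTable ps E).map Prod.fst, k.2 < ps.length) :
    (E.map fun s => (s.2.1 : ℝ) * (n.descFactorial s.1 * signMean n q s.2.2 ^ 2)).sum =
      ((patternTable ps E).map fun t =>
        (t.2 : ℝ) * (n.descFactorial t.1.1 * signMean t.1.1 q (ps.getD t.1.2 []) ^ 2)).sum := by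
  induction E with
  | nil => simp [patternTable]
  | cons s E ih =>
    have hE' : ∀ s ∈ E, ∀ e ∈ s.2.2, e.1 < e.2 ∧ e.2 < s.1 :=
      fun t ht => hE t (List.mem_cons_of_mem _ ht)
    have hs := hE s List.mem_cons_self
    rw [List.map_cons, List.sum_cons]
    rw [patternTable] at hps ⊢
    split_ifs at hps ⊢ with hi
    · rw [ih hE' hps]
      rcases le_or_gt s.1 n with h | h
      · rw [signMean_eq_zero_of_hasIsolatedEdge
          (fun e he => ⟨(hs e he).1, (hs e he).2.trans_le h⟩) hi]
        simp
      · simp [Nat.descFactorial_of_lt h]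
    · have hkeys := keys_subset_addWeight (s.1, patternIndex ps s.1 s.2.2) s.2.1 (patternTable ps E)
      rw [sum_addWeight (fun k : ℕ × ℕ =>
          n.descFactorial k.1 * signMean k.1 q (ps.getD k.2 []) ^ 2),
        ih hE' fun k hk => hps k (hkeys.2 k hk)]
      congr 2
      rcases le_or_gt s.1 n with h | h
      · have hlt : patternIndex ps s.1 s.2.2 < ps.length := hps _ hkeys.1
        have hm : matchesPattern s.1 s.2.2 (ps.getD (patternIndex ps s.1 s.2.2) []) = true := by
          rw [List.getD_eq_getElem _ _ hlt]
          exact List.findIdx_getElem (w := hlt)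
        rw [signMean_sq_of_matchesPattern h hm]
      · simp [Nat.descFactorial_of_lt h]

theorem edgeSum_nil_eq [NeZero q] (r : ℕ) (ps : List (List (ℕ × ℕ))) (T : List ((ℕ × ℕ) × ℕ))
    (hT : patternTable ps (edgeExtensions r 0 1 []) = T) (hps : ∀ t ∈ T, t.1.2 < ps.length) :
    edgeSum n q r [] = (T.map fun t =>
      (t.2 : ℝ) * (n.descFactorial t.1.1 * signMean t.1.1 q (ps.getD t.1.2 []) ^ 2)).sum := by
  have h := edgeSum_eq_sum_edgeExtensions (n := n) (q := q) r 0 1 [] (by simp)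
  rw [sum_eq_sum_patternTable ps _ (fun s hs => edgeExtensions_spec (by simp) hs)
    (by rw [hT]; simpa using hps), hT] at h
  simpa using h

end

/-! ### Multiplicities of the patterns, by kernel computation -/

theorem patternTable_twoEdges :
    patternTable twoEdgePatterns (edgeExtensions 2 0 1 []) = [((3, 1), 4), ((2, 0), 2)] := by
  decide +kernel

theorem patternTable_fourEdges :
    patternTable fourEdgePatterns (edgeExtensions 4 0 1 []) =
      [((6, 14), 48), ((5, 13), 192), ((5, 12), 192), ((5, 10), 48), ((4, 6), 192), ((4, 7), 12),
        ((4, 5), 96), ((4, 8), 192), ((4, 9), 48), ((5, 11), 16), ((4, 4), 96), ((3, 1), 64),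
        ((3, 3), 96), ((3, 2), 48), ((2, 0), 8)] := by
  decide +kernel

/-! ### Averages of sign products -/

section
open scoped BigOperators

theorem expect_vecCons {p : ℕ} {β : Type*} [Fintype β] (F : (Fin (p + 1) → β) → ℝ) :
    𝔼 x : Fin (p + 1) → β, F x = 𝔼 a : β, 𝔼 y : Fin p → β, F (Matrix.vecCons a y) := by
  rw [← Fintype.expect_equiv (Fin.consEquiv fun _ : Fin (p + 1) => β)
    (fun z : β × (Fin p → β) => F (Matrix.vecCons z.1 z.2)) F (fun z => rfl),
    ← Finset.univ_product_univ, Finset.expect_product]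

variable {q : ℕ}

theorem expect_fin_eq (f : ℕ → ℝ) :
    𝔼 a : Fin q, f a = (∑ a ∈ Finset.range q, f a) / q := by
  rw [Fintype.expect_eq_sum_div_card, Fintype.card_fin, Fin.sum_univ_eq_sum_range]

theorem sum_range_quartic (m : ℕ) (c₀ c₁ c₂ c₃ c₄ : ℝ) :
    ∑ a ∈ Finset.range m, (c₀ + c₁ * a + c₂ * (a : ℝ) ^ 2 + c₃ * (a : ℝ) ^ 3 + c₄ * (a : ℝ) ^ 4) =
      c₀ * m + c₁ * (m * (m - 1) / 2) + c₂ * ((m - 1) * m * (2 * m - 1) / 6) +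
        c₃ * (m * (m - 1) / 2) ^ 2 +
        c₄ * ((m - 1) * m * (2 * m - 1) * (3 * m ^ 2 - 3 * m - 1) / 30) := by
  induction m with
  | zero => simp
  | succ m ih =>
    rw [Finset.sum_range_succ, ih]
    push_cast
    ring

theorem ordSign_mul_self {α : Type*} [LinearOrder α] (a b : α) :
    ordSign a b * ordSign a b = 1 - if a = b then 1 else 0 := by
  unfold ordSign
  rcases lt_trichotomy a b with h | h | h
  · simp [h, h.not_gt, h.ne]
  · simp [h]
  · simp [h, h.ne']

theorem expect_ordSign_mul (a : Fin q) (f : ℕ → ℝ) :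
    𝔼 c : Fin q, ordSign a c * f c =
      (2 * ∑ c ∈ Finset.range a, f c + f a - ∑ c ∈ Finset.range q, f c) / q := by
  -- This is sgn(a - c) = 2·1[c < a] + 1[c = a] - 1, which turns averages against a sign into
  -- partial sums.
  have h : ∀ c : Fin q, ordSign a c * f c =
      (fun k : ℕ => 2 * (if k < a then f k else 0) + (if k = (a : ℕ) then f k else 0) - f k) c := by
    intro c
    unfold ordSign
    rcases lt_trichotomy a c with h | h | h
    · have h' : (a : ℕ) < c := h
      simp [h, h.not_gt, h'.not_gt, h'.ne']
    · simp [h]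
    · have h' : (c : ℕ) < a := h
      simp [h, h', h'.ne]
      ring
  rw [Finset.expect_congr rfl fun c _ => h c, expect_fin_eq fun k : ℕ =>
    2 * (if k < a then f k else 0) + (if k = (a : ℕ) then f k else 0) - f k, Finset.sum_sub_distrib, Finset.sum_add_distrib, ← Finset.mul_sum,
    ← Finset.sum_filter, Finset.sum_ite_eq', if_pos (Finset.mem_range.2 a.2)]
  congr 5
  ext k
  simp only [Finset.mem_filter, Finset.mem_range]
  have := a.2
  omega

theorem expect_ordSign (a : Fin q) :
    𝔼 c : Fin q, ordSign a c = (2 * a - q + 1) / q := by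
  have h := expect_ordSign_mul a fun _ => 1
  simp only [mul_one] at h
  rw [h]
  simp
  ring

theorem expect_ordSign_left (a : Fin q) :
    𝔼 c : Fin q, ordSign c a = -((2 * a - q + 1) / q) := by
  simp only [ordSign_swap a]
  rw [Finset.expect_neg_distrib, expect_ordSign]

variable [NeZero q]

theorem cast_ne_zero_of_neZero : (q : ℝ) ≠ 0 := Nat.cast_ne_zero.2 (NeZero.ne q)

theorem expect_ordSign_mul_self (a : Fin q) :
    𝔼 c : Fin q, ordSign a c * ordSign a c = 1 - 1 / q := by
  simp only [ordSign_mul_self]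
  rw [Finset.expect_sub_distrib, Fintype.expect_const, Fintype.expect_eq_sum_div_card]
  simp

theorem sum_range_centred (m : ℕ) :
    ∑ c ∈ Finset.range m, ((2 * c - q + 1) / q : ℝ) = m * (m - q) / q := by
  have hq := cast_ne_zero_of_neZero (q := q)
  induction m with
  | zero => simp
  | succ m ih =>
    rw [Finset.sum_range_succ, ih]
    push_cast
    field_simp
    ring

/-- Two successive edges of a path: averaging out the far end gives the linear function of
`expect_ordSign`, and averaging out the middle vertex gives this quadratic. -/
theorem expect_ordSign_mul_centred (a : Fin q) :
    𝔼 c : Fin q, ordSign a c * ((2 * c - q + 1) / q) =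
      (2 * a ^ 2 - 2 * a * q + 2 * a - q + 1) / q ^ 2 := by
  have hq := cast_ne_zero_of_neZero (q := q)
  rw [expect_ordSign_mul a fun c => (2 * (c : ℝ) - q + 1) / q, sum_range_centred, sum_range_centred]
  field_simp
  ring

theorem expect_centred : 𝔼 a : Fin q, ((2 * a - q + 1) / q : ℝ) = 0 := by
  rw [expect_fin_eq fun a => ((2 * a - q + 1) / q : ℝ), sum_range_centred]
  simp

/-- The average of a polynomial of degree at most four. -/
theorem expect_quartic (c₀ c₁ c₂ c₃ c₄ : ℝ) :
    𝔼 a : Fin q, (c₀ + c₁ * a + c₂ * (a : ℝ) ^ 2 + c₃ * (a : ℝ) ^ 3 + c₄ * (a : ℝ) ^ 4) =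
      c₀ + c₁ * ((q - 1) / 2) + c₂ * ((q - 1) * (2 * q - 1) / 6) +
        c₃ * (q * (q - 1) ^ 2 / 4) +
        c₄ * ((q - 1) * (2 * q - 1) * (3 * q ^ 2 - 3 * q - 1) / 30) := by
  rw [expect_fin_eq fun a =>
    c₀ + c₁ * a + c₂ * (a : ℝ) ^ 2 + c₃ * (a : ℝ) ^ 3 + c₄ * (a : ℝ) ^ 4, sum_range_quartic]
  have hq := cast_ne_zero_of_neZero (q := q)
  field_simp
  ring

theorem expect_centred_sq :
    𝔼 a : Fin q, ((2 * a - q + 1) / q * ((2 * a - q + 1) / q) : ℝ) = (q ^ 2 - 1) / (3 * q ^ 2) := by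
  have hq := cast_ne_zero_of_neZero (q := q)
  simp_rw [fun a : Fin q => show ((2 * a - q + 1) / q * ((2 * a - q + 1) / q) : ℝ) =
    (1 - q) ^ 2 / q ^ 2 + 4 * (1 - q) / q ^ 2 * a + 4 / q ^ 2 * (a : ℝ) ^ 2 + 0 * (a : ℝ) ^ 3 +
      0 * (a : ℝ) ^ 4 by field_simp; ring]
  rw [expect_quartic]
  field_simp
  ring

theorem expect_centred_pow_four :
    𝔼 a : Fin q, (((2 * a - q + 1) / q) ^ 4 : ℝ) =
      (q ^ 2 - 1) * (3 * q ^ 2 - 7) / (15 * q ^ 4) := by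
  have hq := cast_ne_zero_of_neZero (q := q)
  simp_rw [fun a : Fin q => show (((2 * a - q + 1) / q) ^ 4 : ℝ) =
    (1 - q) ^ 4 / q ^ 4 + 8 * (1 - q) ^ 3 / q ^ 4 * a + 24 * (1 - q) ^ 2 / q ^ 4 * (a : ℝ) ^ 2 +
      32 * (1 - q) / q ^ 4 * (a : ℝ) ^ 3 + 16 / q ^ 4 * (a : ℝ) ^ 4 by field_simp; ring]
  rw [expect_quartic]
  field_simp
  ring

theorem expect_centred_sq_mul :
    𝔼 a : Fin q, ((2 * a - q + 1) / q * ((2 * a - q + 1) / q) *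
      ((2 * a ^ 2 - 2 * a * q + 2 * a - q + 1) / q ^ 2) : ℝ) =
      -((q ^ 2 - 1) * (q ^ 2 + 1)) / (15 * q ^ 4) := by
  have hq := cast_ne_zero_of_neZero (q := q)
  simp_rw [fun a : Fin q => show ((2 * a - q + 1) / q * ((2 * a - q + 1) / q) *
      ((2 * a ^ 2 - 2 * a * q + 2 * a - q + 1) / q ^ 2) : ℝ) =
    (1 - q) ^ 3 / q ^ 4 + (4 * (1 - q) ^ 2 + 2 * (1 - q) ^ 3) / q ^ 4 * a +
      (4 * (1 - q) + 8 * (1 - q) ^ 2 + 2 * (1 - q) ^ 2) / q ^ 4 * (a : ℝ) ^ 2 +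
      (8 * (1 - q) + 8 * (1 - q)) / q ^ 4 * (a : ℝ) ^ 3 + 8 / q ^ 4 * (a : ℝ) ^ 4 by
    field_simp; ring]
  rw [expect_quartic]
  field_simp
  ring

theorem expect_quadratic_sq :
    𝔼 a : Fin q, (((2 * a ^ 2 - 2 * a * q + 2 * a - q + 1) / q ^ 2) ^ 2 : ℝ) =
      (q ^ 2 - 1) * (2 * q ^ 2 - 3) / (15 * q ^ 4) := by
  have hq := cast_ne_zero_of_neZero (q := q)
  simp_rw [fun a : Fin q => show
    (((2 * a ^ 2 - 2 * a * q + 2 * a - q + 1) / q ^ 2) ^ 2 : ℝ) =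
    (1 - q) ^ 2 / q ^ 4 + 4 * (1 - q) ^ 2 / q ^ 4 * a +
      (4 * (1 - q) ^ 2 + 4 * (1 - q)) / q ^ 4 * (a : ℝ) ^ 2 +
      8 * (1 - q) / q ^ 4 * (a : ℝ) ^ 3 + 4 / q ^ 4 * (a : ℝ) ^ 4 by
    field_simp; ring]
  rw [expect_quartic]
  field_simp
  ring

theorem sum_sum_range_eq_of_symm (H : ℕ → ℕ → ℝ) (hsymm : ∀ a b, H b a = H a b) (m : ℕ) :
    ∑ a ∈ Finset.range m, ∑ b ∈ Finset.range m, H a b =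
      ∑ a ∈ Finset.range m, (H a a + 2 * ∑ b ∈ Finset.range a, H a b) := by
  induction m with
  | zero => simp
  | succ m ih =>
    rw [Finset.sum_range_succ (fun a => H a a + _)]
    simp only [Finset.sum_range_succ _ m, Finset.sum_add_distrib] at ih ⊢
    rw [ih]
    simp only [hsymm _ m]
    ring

theorem expect_ordSign_mul_ordSign (a b : Fin q) :
    𝔼 d : Fin q, ordSign d a * ordSign d b =
      (2 * ∑ d ∈ Finset.range a, ordSign (b : ℕ) d + ordSign (b : ℕ) a - (2 * b - q + 1)) / q := by
  have h : ∀ d : Fin q, ordSign d a * ordSign d b = ordSign a d * (fun k => ordSign (b : ℕ) k) d := by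
    intro d
    rw [ordSign_swap a d, ordSign_swap b d, neg_mul_neg]
    rfl
  rw [Finset.expect_congr rfl fun d _ => h d, expect_ordSign_mul]
  have hs : ∑ d ∈ Finset.range q, ordSign (b : ℕ) d = 2 * b - q + 1 := by
    have h1 := expect_ordSign b
    have h2 : 𝔼 c : Fin q, ordSign b c = (∑ d ∈ Finset.range q, ordSign (b : ℕ) d) / q :=
      expect_fin_eq fun d => ordSign (b : ℕ) d
    have hq := cast_ne_zero_of_neZero (q := q)
    rw [h1, div_left_inj' hq] at h2
    exact h2.symm
  rw [hs]

/-- The b - a - 1 values strictly between contribute -1, the values a and b contribute 0, and all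
others contribute 1. -/
theorem expect_ordSign_mul_ordSign_of_lt {a b : Fin q} (h : a < b) :
    𝔼 d : Fin q, ordSign d a * ordSign d b = (q - 2 * ((b : ℝ) - a)) / q := by
  have h' : (a : ℕ) < b := h
  have hs : ∑ d ∈ Finset.range a, ordSign (b : ℕ) d = a := by
    rw [Finset.sum_congr rfl fun d hd => show ordSign (b : ℕ) d = 1 by
      have := Finset.mem_range.1 hd
      simp [ordSign, show d < (b : ℕ) by omega]]
    simp
  rw [expect_ordSign_mul_ordSign, hs, show ordSign (b : ℕ) a = 1 by simp [ordSign, h']]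
  ring

/-- The average over the closed walks of length four. -/
theorem expect_fourCycle :
    𝔼 a : Fin q, 𝔼 b : Fin q, (𝔼 d : Fin q, ordSign d a * ordSign d b) ^ 2 =
      ((q : ℝ) - 1) * (q ^ 2 + q - 3) / (3 * q ^ 3) := by
  have hq := cast_ne_zero_of_neZero (q := q)
  -- The diagonal is separate: the off-diagonal formula would give 1 at a = b, but ties lower the
  -- mean to 1 - 1/q.
  let H : ℕ → ℕ → ℝ := fun a b =>
    if a = b then ((q - 1) / q) ^ 2 else ((q - 2 * |(a : ℝ) - b|) / q) ^ 2
  have hH : ∀ a b : Fin q, (𝔼 d : Fin q, ordSign d a * ordSign d b) ^ 2 = H a b := by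
    intro a b
    rcases lt_trichotomy a b with h | h | h
    · have h' : (a : ℕ) < b := h
      have h'' : (a : ℝ) < b := by exact_mod_cast h'
      simp only [H, if_neg h'.ne]
      rw [expect_ordSign_mul_ordSign_of_lt h, abs_of_neg (by linarith)]
      ring
    · subst h
      simp only [H]
      rw [if_true, Finset.expect_congr rfl fun d _ =>
        show ordSign d a * ordSign d a = ordSign a d * ordSign a d by
          rw [ordSign_swap a d, neg_mul_neg], expect_ordSign_mul_self]
      field_simp
    · have h' : (b : ℕ) < a := h
      have h'' : (b : ℝ) < a := by exact_mod_cast h'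
      simp only [H, if_neg h'.ne']
      rw [Finset.expect_congr rfl fun d _ => mul_comm _ _, expect_ordSign_mul_ordSign_of_lt h,
        abs_of_pos (by linarith)]
  have hin : ∀ a : ℕ, ∑ b ∈ Finset.range a, H a b =
      ((q - 2 * a) ^ 2 * a + 4 * (q - 2 * a) * (a * (a - 1) / 2) +
        4 * ((a - 1) * a * (2 * a - 1) / 6)) / q ^ 2 := by
    intro a
    have h1 : ∀ b ∈ Finset.range a, H a b = ((q - 2 * a) ^ 2 / q ^ 2 +
        4 * (q - 2 * a) / q ^ 2 * b + 4 / q ^ 2 * (b : ℝ) ^ 2 + 0 * (b : ℝ) ^ 3 +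
        0 * (b : ℝ) ^ 4) := by
      intro b hb
      have hb' := Finset.mem_range.1 hb
      have hb'' : (b : ℝ) < a := by exact_mod_cast hb'
      simp only [H, if_neg hb'.ne']
      rw [abs_of_pos (by linarith)]
      field_simp
      ring
    rw [Finset.sum_congr rfl h1, sum_range_quartic]
    field_simp
    ring
  have hout : ∀ a : Fin q, 𝔼 b : Fin q, H a b = (∑ b ∈ Finset.range q, H a b) / q := fun a =>
    expect_fin_eq (H a)
  simp_rw [hH, hout]
  rw [← Finset.expect_div, expect_fin_eq fun a => ∑ b ∈ Finset.range q, H a b,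
    -- Restricting to b < a removes the absolute value and leaves a polynomial sum.
    sum_sum_range_eq_of_symm H (fun a b => by simp only [H, eq_comm, abs_sub_comm])]
  have h2 : ∀ a ∈ Finset.range q, H a a + 2 * ∑ b ∈ Finset.range a, H a b =
      ((q - 1) / q) ^ 2 + (2 * q ^ 2 - 4 * q + 4 / 3) / q ^ 2 * a +
        (-4 * q + 4) / q ^ 2 * (a : ℝ) ^ 2 + 8 / 3 / q ^ 2 * (a : ℝ) ^ 3 + 0 * (a : ℝ) ^ 4 := by
    intro a _
    rw [hin]
    simp only [H, if_true]
    field_simp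
    ring
  rw [Finset.sum_congr rfl h2, sum_range_quartic]
  field_simp
  ring

end

/-! ### Means of the individual patterns: leaves are averaged out first, doubled edges by sgn² = 1 -
1[tie] -/

section
open scoped BigOperators

theorem ordSign_cube {α : Type*} [LinearOrder α] (a b : α) :
    ordSign a b * (ordSign a b * ordSign a b) = ordSign a b := by
  unfold ordSign
  split_ifs <;> norm_num

variable {q : ℕ}

theorem expect_ite_eq_mul (a : Fin q) (f : Fin q → ℝ) :
    𝔼 b : Fin q, (if a = b then 1 else 0) * f b = f a / q := by
  rw [Fintype.expect_eq_sum_div_card]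
  simp

/-- Exchanging the vertices 1 and 2 of the triangle maps the graph to itself and reverses only the
edge between them, so the mean is 0. -/
theorem signMean_paw :
    signMean 4 q [(0, 1), (0, 2), (0, 3), (1, 2)] = 0 := by
  simp only [signMean, signProd_cons, signProd_nil, edgeSign]
  simp [expect_vecCons]
  refine Finset.expect_eq_zero fun a _ => ?_
  have h : ∀ b c d : Fin q, ordSign a b * (ordSign a c * (ordSign a d * ordSign b c)) =
      -(ordSign a c * (ordSign a b * (ordSign a d * ordSign c b))) := by
    intro b c d
    rw [ordSign_swap b c]
    ring
  have h' : 𝔼 b : Fin q, 𝔼 c : Fin q, 𝔼 d : Fin q,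
      ordSign a b * (ordSign a c * (ordSign a d * ordSign b c)) =
      -𝔼 b : Fin q, 𝔼 c : Fin q, 𝔼 d : Fin q,
        ordSign a b * (ordSign a c * (ordSign a d * ordSign b c)) := by
    conv_lhs => rw [Finset.expect_comm]
    rw [← Finset.expect_neg_distrib]
    refine Finset.expect_congr rfl fun c _ => ?_
    rw [← Finset.expect_neg_distrib]
    refine Finset.expect_congr rfl fun b _ => ?_
    rw [← Finset.expect_neg_distrib]
    exact Finset.expect_congr rfl fun d _ => h b c d
  linarith

variable [NeZero q]

theorem signMean_doubleEdge : signMean 2 q [(0, 1), (0, 1)] = 1 - 1 / q := by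
  simp only [signMean, signProd_cons, signProd_nil, edgeSign]
  simp [expect_vecCons, expect_ordSign_mul_self]

theorem signMean_path_three :
    signMean 3 q [(0, 1), (0, 2)] = (q ^ 2 - 1) / (3 * q ^ 2) := by
  simp only [signMean, signProd_cons, signProd_nil, edgeSign]
  simp [expect_vecCons]
  simp only [← Finset.mul_expect, ← Finset.expect_mul, expect_ordSign, expect_centred_sq]

theorem signMean_quadrupleEdge :
    signMean 2 q [(0, 1), (0, 1), (0, 1), (0, 1)] = 1 - 1 / q := by
  simp only [signMean, signProd_cons, signProd_nil, edgeSign]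
  simp [expect_vecCons, ordSign_cube, expect_ordSign_mul_self]

theorem signMean_tripleEdge_path :
    signMean 3 q [(0, 1), (0, 1), (0, 1), (0, 2)] = (q ^ 2 - 1) / (3 * q ^ 2) := by
  simp only [signMean, signProd_cons, signProd_nil, edgeSign]
  simp [expect_vecCons]
  simp_rw [fun a b c : Fin q => show ordSign a b * (ordSign a b * (ordSign a b * ordSign a c)) =
    ordSign a b * (ordSign a b * ordSign a b) * ordSign a c by ring, ordSign_cube]
  simp only [← Finset.mul_expect, ← Finset.expect_mul, expect_ordSign, expect_centred_sq]

theorem signMean_doubleEdge_doubleEdge :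
    signMean 3 q [(0, 1), (0, 1), (0, 2), (0, 2)] = (1 - 1 / q) ^ 2 := by
  simp only [signMean, signProd_cons, signProd_nil, edgeSign]
  simp [expect_vecCons]
  simp_rw [fun a b c : Fin q => show ordSign a b * (ordSign a b * (ordSign a c * ordSign a c)) =
    ordSign a b * ordSign a b * (ordSign a c * ordSign a c) by ring]
  simp only [← Finset.mul_expect, ← Finset.expect_mul, expect_ordSign_mul_self,
    Fintype.expect_const]
  ring

theorem signMean_triangle_doubled :
    signMean 3 q [(0, 1), (0, 1), (0, 2), (1, 2)] =
      (q ^ 2 - 1) / (3 * q ^ 2) - (1 - 1 / q) / q := by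
  simp only [signMean, signProd_cons, signProd_nil, edgeSign]
  simp [expect_vecCons]
  -- The doubled edge is 1 - 1[a = b]: the mean is that of the path without this edge minus that of
  -- the graph in which the edge is contracted.
  have h : ∀ a b c : Fin q, ordSign a b * (ordSign a b * (ordSign a c * ordSign b c)) =
      ordSign c a * ordSign c b - (if a = b then 1 else 0) * (ordSign c a * ordSign c b) := by
    intro a b c
    rw [← mul_assoc, ordSign_mul_self, ordSign_swap c a, ordSign_swap c b]
    ring
  simp_rw [h, Finset.expect_sub_distrib, ← Finset.mul_expect, expect_ite_eq_mul]
  simp_rw [← Finset.expect_div]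
  rw [Finset.expect_congr rfl fun a _ => Finset.expect_comm Finset.univ Finset.univ
    fun b c => ordSign c a * ordSign c b, Finset.expect_comm,
    Finset.expect_comm Finset.univ Finset.univ fun a c : Fin q => ordSign c a * ordSign c a]
  simp only [← Finset.mul_expect, ← Finset.expect_mul, expect_ordSign, expect_centred_sq,
    expect_ordSign_mul_self, Fintype.expect_const]
  ring

theorem signMean_doubleEdge_star :
    signMean 4 q [(0, 1), (0, 1), (0, 2), (0, 3)] =
      (1 - 1 / q) * ((q ^ 2 - 1) / (3 * q ^ 2)) := by
  simp only [signMean, signProd_cons, signProd_nil, edgeSign]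
  simp [expect_vecCons]
  simp_rw [fun a b c d : Fin q =>
    show ordSign a b * (ordSign a b * (ordSign a c * ordSign a d)) =
    ordSign a b * ordSign a b * (ordSign a c * ordSign a d) by ring]
  simp only [← Finset.mul_expect, ← Finset.expect_mul, expect_ordSign_mul_self, expect_ordSign,
    expect_centred_sq]
  ring

theorem signMean_path_doubleMiddle :
    signMean 4 q [(0, 1), (0, 1), (0, 2), (1, 3)] = -((q ^ 2 - 1) / (3 * q ^ 2) / q) := by
  simp only [signMean, signProd_cons, signProd_nil, edgeSign]
  simp [expect_vecCons]
  -- Removing the doubled edge leaves two disjoint single edges, of mean 0; only the contracted term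
  -- survives.
  have h : ∀ a b c d : Fin q, ordSign a b * (ordSign a b * (ordSign a c * ordSign b d)) =
      ordSign a c * ordSign b d - (if a = b then 1 else 0) * (ordSign a c * ordSign b d) := by
    intro a b c d
    rw [← mul_assoc, ordSign_mul_self]
    ring
  simp_rw [h, Finset.expect_sub_distrib, ← Finset.mul_expect, expect_ordSign, ← Finset.expect_mul,
    expect_ordSign, expect_ite_eq_mul]
  simp only [← Finset.mul_expect, ← Finset.expect_mul, expect_centred]
  rw [← Finset.expect_div, expect_centred_sq]
  ring

theorem signMean_path_doubleEnd :
    signMean 4 q [(0, 1), (0, 1), (0, 2), (2, 3)] =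
      -((1 - 1 / q) * ((q ^ 2 - 1) / (3 * q ^ 2))) := by
  simp only [signMean, signProd_cons, signProd_nil, edgeSign]
  simp [expect_vecCons]
  simp_rw [fun a b c d : Fin q =>
    show ordSign a b * (ordSign a b * (ordSign a c * ordSign c d)) =
    ordSign a b * ordSign a b * (ordSign a c * ordSign c d) by ring]
  simp only [← Finset.mul_expect, ← Finset.expect_mul, expect_ordSign_mul_self, expect_ordSign]
  rw [Finset.expect_comm]
  simp only [← Finset.expect_mul, expect_ordSign_left, neg_mul, Finset.expect_neg_distrib,
    expect_centred_sq]
  ring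

theorem signMean_doubleEdges_disjoint :
    signMean 4 q [(0, 1), (0, 1), (2, 3), (2, 3)] = (1 - 1 / q) ^ 2 := by
  simp only [signMean, signProd_cons, signProd_nil, edgeSign]
  simp [expect_vecCons]
  simp_rw [fun a b c d : Fin q =>
    show ordSign a b * (ordSign a b * (ordSign c d * ordSign c d)) =
    ordSign a b * ordSign a b * (ordSign c d * ordSign c d) by ring]
  simp only [← Finset.mul_expect, ← Finset.expect_mul, expect_ordSign_mul_self,
    Fintype.expect_const]
  ring

theorem signMean_fourCycle :
    signMean 4 q [(0, 1), (0, 2), (1, 3), (2, 3)] =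
      ((q : ℝ) - 1) * (q ^ 2 + q - 3) / (3 * q ^ 3) := by
  simp only [signMean, signProd_cons, signProd_nil, edgeSign]
  simp [expect_vecCons]
  rw [← expect_fourCycle, Finset.expect_comm]
  refine Finset.expect_congr rfl fun b _ => ?_
  rw [Finset.expect_comm]
  refine Finset.expect_congr rfl fun c _ => ?_
  have h : ∀ a d : Fin q, ordSign a b * (ordSign a c * (ordSign b d * ordSign c d)) =
      ordSign a b * ordSign a c * (ordSign d b * ordSign d c) := by
    intro a d
    rw [ordSign_swap d b, ordSign_swap d c]
    ring
  simp only [h, ← Finset.mul_expect, ← Finset.expect_mul]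
  ring

theorem signMean_doubleEdge_path_disjoint :
    signMean 5 q [(0, 1), (0, 1), (2, 3), (2, 4)] =
      (1 - 1 / q) * ((q ^ 2 - 1) / (3 * q ^ 2)) := by
  simp only [signMean, signProd_cons, signProd_nil, edgeSign]
  simp [expect_vecCons]
  simp_rw [fun a b c d e : Fin q =>
    show ordSign a b * (ordSign a b * (ordSign c d * ordSign c e)) =
    ordSign a b * ordSign a b * (ordSign c d * ordSign c e) by ring]
  simp only [← Finset.mul_expect, ← Finset.expect_mul, expect_ordSign_mul_self, expect_ordSign,
    expect_centred_sq, Fintype.expect_const]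
  ring

theorem signMean_star :
    signMean 5 q [(0, 1), (0, 2), (0, 3), (0, 4)] =
      (q ^ 2 - 1) * (3 * q ^ 2 - 7) / (15 * q ^ 4) := by
  simp only [signMean, signProd_cons, signProd_nil, edgeSign]
  simp [expect_vecCons]
  simp only [← Finset.mul_expect, ← Finset.expect_mul, expect_ordSign]
  rw [← expect_centred_pow_four]
  refine Finset.expect_congr rfl fun a _ => ?_
  ring

theorem signMean_fork :
    signMean 5 q [(0, 1), (0, 2), (0, 3), (1, 4)] =
      -((q ^ 2 - 1) * (q ^ 2 + 1)) / (15 * q ^ 4) := by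
  simp only [signMean, signProd_cons, signProd_nil, edgeSign]
  simp [expect_vecCons]
  simp_rw [fun a b c d e : Fin q =>
    show ordSign a b * (ordSign a c * (ordSign a d * ordSign b e)) =
    ordSign a c * ordSign a d * (ordSign a b * ordSign b e) by ring]
  simp only [← Finset.mul_expect, ← Finset.expect_mul, expect_ordSign, expect_ordSign_mul_centred]
  rw [expect_centred_sq_mul]

theorem signMean_path_five :
    signMean 5 q [(0, 1), (0, 2), (1, 3), (2, 4)] =
      (q ^ 2 - 1) * (2 * q ^ 2 - 3) / (15 * q ^ 4) := by
  simp only [signMean, signProd_cons, signProd_nil, edgeSign]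
  simp [expect_vecCons]
  simp_rw [fun a b c d e : Fin q =>
    show ordSign a b * (ordSign a c * (ordSign b d * ordSign c e)) =
    ordSign a b * ordSign b d * (ordSign a c * ordSign c e) by ring]
  simp only [← Finset.mul_expect, ← Finset.expect_mul, expect_ordSign, expect_ordSign_mul_centred]
  rw [← expect_quadratic_sq]
  refine Finset.expect_congr rfl fun a _ => ?_
  ring

theorem signMean_paths_disjoint :
    signMean 6 q [(0, 1), (0, 2), (3, 4), (3, 5)] = ((q ^ 2 - 1) / (3 * q ^ 2)) ^ 2 := by
  simp only [signMean, signProd_cons, signProd_nil, edgeSign]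
  simp [expect_vecCons]
  simp_rw [fun a b c d e f : Fin q =>
    show ordSign a b * (ordSign a c * (ordSign d e * ordSign d f)) =
    ordSign a b * ordSign a c * (ordSign d e * ordSign d f) by ring]
  simp only [← Finset.mul_expect, ← Finset.expect_mul, expect_ordSign, expect_centred_sq]
  ring

end

/-! ### Second and fourth moments of the concordance in closed form -/

section
variable {n : ℕ}

theorem edgeSum_two [NeZero n] :
    edgeSum n n 2 [] = 4 * (((n : ℝ) - 1) ^ 3 * (2 * n ^ 3 + 9 * n ^ 2 - 6 * n - 4) / (18 * n ^ 3)) := by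
  have hn := cast_ne_zero_of_neZero (q := n)
  rw [edgeSum_nil_eq 2 _ _ patternTable_twoEdges (by decide)]
  simp only [twoEdgePatterns, List.map_cons, List.map_nil, List.sum_cons, List.sum_nil,
    List.getD_cons_zero, List.getD_cons_succ, signMean_doubleEdge, signMean_path_three,
    cast_descFactorial_succ, Nat.descFactorial_zero]
  push_cast
  field_simp
  ring

theorem edgeSum_four [NeZero n] :
    edgeSum n n 4 [] = 16 * (((n : ℝ) - 1) ^ 3 *
      (300 * n ^ 10 + 1584 * n ^ 9 - 4113 * n ^ 8 - 17601 * n ^ 7 + 34245 * n ^ 6 + 100773 * n ^ 5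
        - 220962 * n ^ 4 - 68040 * n ^ 3 + 359064 * n ^ 2 - 108048 * n - 110016) /
      (8100 * n ^ 7)) := by
  have hn := cast_ne_zero_of_neZero (q := n)
  rw [edgeSum_nil_eq 4 _ _ patternTable_fourEdges (by decide)]
  simp only [fourEdgePatterns, List.map_cons, List.map_nil, List.sum_cons, List.sum_nil,
    List.getD_cons_zero, List.getD_cons_succ, signMean_quadrupleEdge, signMean_tripleEdge_path,
    signMean_doubleEdge_doubleEdge, signMean_triangle_doubled, signMean_doubleEdge_star,
    signMean_path_doubleMiddle, signMean_path_doubleEnd, signMean_doubleEdges_disjoint,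
    signMean_paw, signMean_fourCycle, signMean_doubleEdge_path_disjoint, signMean_star,
    signMean_fork, signMean_path_five, signMean_paths_disjoint,
    cast_descFactorial_succ, Nat.descFactorial_zero]
  push_cast
  field_simp
  ring

end

/-! ### The Kemeny distance of two random rankings -/

noncomputable section

/-- Twice the number of concordant pairs minus twice the number of discordant pairs. -/
def concordance {n q : ℕ} (x y : Fin n → Fin q) : ℝ :=
  ∑ k, ∑ l, ordSign (x k) (x l) * ordSign (y k) (y l)

theorem kemenyScore_apply {n : ℕ} {α : Type*} [LinearOrder α] (x : Fin n → α) (k l : Fin n) :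
    kemenyScore x k l = √(1 / 2) * ordSign (x k) (x l) := by
  simp only [kemenyScore, Matrix.of_apply, ordSign]
  split_ifs <;> simp

theorem kemenyDist_eq {n : ℕ} (x y : Fin n → Fin n) :
    kemenyDist x y = ((n : ℝ) ^ 2 - n) / 2 - concordance x y / 2 := by
  have h : ∀ k l, (kemenyScore x ⊙ (kemenyScore y)ᵀ) k l =
      -(1 / 2) * (ordSign (x k) (x l) * ordSign (y k) (y l)) := by
    intro k l
    rw [Matrix.hadamard_apply, Matrix.transpose_apply, kemenyScore_apply, kemenyScore_apply,
      ordSign_swap (y k) (y l)]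
    have := Real.mul_self_sqrt (show (0 : ℝ) ≤ 1 / 2 by norm_num)
    linear_combination (-(ordSign (x k) (x l) * ordSign (y k) (y l))) * this
  simp only [kemenyDist, h, ← Finset.mul_sum, concordance]
  ring

theorem concordance_of_const_left {n : ℕ} {x : Fin n → Fin n} (hx : x ∉ kemenyPopulation n)
    (y : Fin n → Fin n) : concordance x y = 0 := by
  simp only [kemenyPopulation, Set.mem_ofPred_eq, not_exists, ne_eq, not_not] at hx
  refine Finset.sum_eq_zero fun k _ => Finset.sum_eq_zero fun l _ => ?_
  rw [hx k l, ordSign_self, zero_mul]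

theorem concordance_comm {n q : ℕ} (x y : Fin n → Fin q) :
    concordance x y = concordance y x := by
  simp only [concordance, mul_comm]

theorem concordance_eq_sum_range {n q : ℕ} (x y : Fin n → Fin q) :
    concordance x y =
      ∑ k ∈ Finset.range n, ∑ l ∈ Finset.range n, edgeSign x (k, l) * edgeSign y (k, l) := by
  rw [concordance, ← Fin.sum_univ_eq_sum_range
    fun k => ∑ l ∈ Finset.range n, edgeSign x (k, l) * edgeSign y (k, l)]
  refine Finset.sum_congr rfl fun k _ => ?_
  rw [← Fin.sum_univ_eq_sum_range fun l => edgeSign x (k, l) * edgeSign y (k, l)]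
  refine Finset.sum_congr rfl fun l _ => ?_
  simp [edgeSign]

section
open scoped BigOperators

/-- Each factor of the power, once expanded, adds one edge to both sign products; carrying `L` along
makes the induction close. At r = 0 independence factors the average into two equal means, hence the
square. -/
theorem expect_signProd_mul_concordance_pow {n q : ℕ} (r : ℕ) (L : List (ℕ × ℕ)) :
    𝔼 x : Fin n → Fin q, 𝔼 y : Fin n → Fin q,
      signProd x L * signProd y L * concordance x y ^ r = edgeSum n q r L := by
  induction r generalizing L with
  | zero =>
    simp only [pow_zero, mul_one, ← Finset.mul_expect, ← Finset.expect_mul]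
    exact (sq _).symm
  | succ r ih =>
    simp only [edgeSum, ← ih, ← Finset.expect_sum_comm]
    refine Finset.expect_congr rfl fun x _ => Finset.expect_congr rfl fun y _ => ?_
    rw [pow_succ', ← mul_assoc, concordance_eq_sum_range x y, Finset.mul_sum, Finset.sum_mul]
    refine Finset.sum_congr rfl fun k _ => ?_
    rw [Finset.mul_sum, Finset.sum_mul]
    refine Finset.sum_congr rfl fun l _ => ?_
    rw [signProd_cons, signProd_cons]
    ring

theorem expect_concordance_pow {n q : ℕ} (r : ℕ) :
    𝔼 x : Fin n → Fin q, 𝔼 y : Fin n → Fin q, concordance x y ^ r = edgeSum n q r [] := by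
  rw [← expect_signProd_mul_concordance_pow]
  simp

theorem expect_concordance {n q : ℕ} [NeZero q] :
    𝔼 x : Fin n → Fin q, 𝔼 y : Fin n → Fin q, concordance x y = 0 := by
  have h := expect_concordance_pow (n := n) (q := q) 1
  simp only [pow_one] at h
  -- A single edge is isolated, so the table for r = 1 is empty and no pattern is needed.
  rw [h, edgeSum_nil_eq 1 [] [] (by decide) (by simp)]
  simp

end

theorem ncard_kemenyPopulation {n : ℕ} (hn : 2 ≤ n) :
    ((kemenyPopulation n).ncard : ℝ) = (n : ℝ) ^ n - n := by
  have hc : (kemenyPopulation n)ᶜ = Set.range (Function.const (Fin n) : Fin n → Fin n → Fin n) := by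
    ext x
    simp only [kemenyPopulation, Set.mem_compl_iff, Set.mem_ofPred_eq, not_exists, ne_eq, not_not,
      Set.mem_range]
    constructor
    · intro h
      exact ⟨x ⟨0, by omega⟩, funext fun k => h _ _⟩
    · rintro ⟨a, rfl⟩ k l
      rfl
  have h := Set.ncard_add_ncard_compl (kemenyPopulation n)
  have : Nonempty (Fin n) := ⟨⟨0, by omega⟩⟩
  have hr : (Set.range (Function.const (Fin n) : Fin n → Fin n → Fin n)).ncard = n := by
    rw [← Set.image_univ, Set.ncard_image_of_injective _ Function.const_injective]
    simp [Set.ncard_univ]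
  rw [hc, hr] at h
  have h' : Nat.card (Fin n → Fin n) = n ^ n := by simp
  rw [h'] at h
  have : ((kemenyPopulation n).ncard : ℝ) + n = (n : ℝ) ^ n := by exact_mod_cast h
  linarith

/-- Expectations of functions of two independent uniform variables are finite sums. -/
theorem integral_comp_of_uniformOn {Ω α E : Type*} [MeasurableSpace Ω] {P : Measure Ω}
    [IsProbabilityMeasure P] [Fintype α] [MeasurableSpace α] [MeasurableSingletonClass α]
    [NormedAddCommGroup E] [NormedSpace ℝ E] [CompleteSpace E]
    {X Y : Ω → α} {s : Set α} [DecidablePred (· ∈ s)] (hX : HasLaw X (uniformOn s) P)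
    (hY : HasLaw Y (uniformOn s) P) (hXY : IndepFun X Y P) (f : α → α → E) :
    ∫ ω, f (X ω) (Y ω) ∂P =
      ∑ x, ∑ y, if x ∈ s ∧ y ∈ s then ((s.ncard : ℝ) ^ 2)⁻¹ • f x y else 0 := by
  have hmap : P.map (fun ω => (X ω, Y ω)) = (uniformOn s).prod (uniformOn s) := by
    rw [(indepFun_iff_map_prod_eq_prod_map_map hX.aemeasurable hY.aemeasurable).1 hXY,
      hX.map_eq, hY.map_eq]
  have : IsProbabilityMeasure (uniformOn s) := hX.map_eq ▸
    Measure.isProbabilityMeasure_map hX.aemeasurable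
  have hs : ∀ x, (uniformOn s).real {x} = if x ∈ s then (s.ncard : ℝ)⁻¹ else 0 := by
    intro x
    rw [measureReal_def, uniformOn, cond_apply s.toFinite.measurableSet]
    split_ifs with h
    · rw [Set.inter_eq_right.2 (by simpa using h), Measure.count_singleton,
        Measure.count_apply_finite _ s.toFinite, ← Set.ncard_eq_toFinset_card _ s.toFinite]
      simp
    · have : s ∩ {x} = ∅ := by
        ext z
        simp only [Set.mem_inter_iff, Set.mem_singleton_iff, Set.mem_empty_iff_false, iff_false]
        rintro ⟨hz, rfl⟩
        exact h hz
      simp [this]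
  have hint := integral_map (hX.aemeasurable.prodMk hY.aemeasurable)
    (f := fun z : α × α => f z.1 z.2) .of_discrete
  rw [hmap] at hint
  rw [← hint, integral_fintype .of_finite, Fintype.sum_prod_type]
  refine Finset.sum_congr rfl fun x _ => Finset.sum_congr rfl fun y _ => ?_
  rw [← Set.singleton_prod_singleton, measureReal_prod_prod, hs, hs]
  by_cases hx : x ∈ s <;> by_cases hy : y ∈ s <;> simp [hx, hy, sq]

/-- After subtracting `φ 0` the summands with a constant vector vanish, so the sum may run over all
vectors, where the coordinates are independent. -/
theorem integral_comp_concordance {n : ℕ} (hn : 2 ≤ n) {Ω E : Type*} [MeasurableSpace Ω]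
    {P : Measure Ω} [IsProbabilityMeasure P] [NormedAddCommGroup E] [NormedSpace ℝ E]
    [CompleteSpace E] {X Y : Ω → Fin n → Fin n}
    (hX : HasLaw X (uniformOn (kemenyPopulation n)) P)
    (hY : HasLaw Y (uniformOn (kemenyPopulation n)) P) (hXY : IndepFun X Y P) (φ : ℝ → E) :
    ∫ ω, φ (concordance (X ω) (Y ω)) ∂P =
      φ 0 + (((n : ℝ) ^ n - n) ^ 2)⁻¹ •
        ∑ x : Fin n → Fin n, ∑ y : Fin n → Fin n, (φ (concordance x y) - φ 0) := by
  classical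
  have h := integral_comp_of_uniformOn hX hY hXY fun x y => φ (concordance x y) - φ 0
  have hZ : AEMeasurable (fun ω => (X ω, Y ω)) P := hX.aemeasurable.prodMk hY.aemeasurable
  have hmap : Integrable (fun z : (Fin n → Fin n) × (Fin n → Fin n) => φ (concordance z.1 z.2))
      (P.map fun ω => (X ω, Y ω)) := .of_finite
  have hint : Integrable (fun ω => φ (concordance (X ω) (Y ω))) P := hmap.comp_aemeasurable hZ
  rw [integral_sub hint (integrable_const _), integral_const, probReal_univ, one_smul,
    sub_eq_iff_eq_add'] at h
  rw [h, Finset.smul_sum]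
  congr 1
  refine Finset.sum_congr rfl fun x _ => ?_
  rw [Finset.smul_sum]
  refine Finset.sum_congr rfl fun y _ => ?_
  rw [ncard_kemenyPopulation hn]
  split_ifs with hxy
  · rfl
  · have : concordance x y = 0 := by
      by_cases hx : x ∈ kemenyPopulation n
      · rw [concordance_comm]
        exact concordance_of_const_left (fun hy => hxy ⟨hx, hy⟩) x
      · exact concordance_of_const_left hx y
    simp [this]

end

/-! ### Moments and kurtosis -/

noncomputable section

/-- The second moment of half the concordance of two uniform vectors of length `n`. -/
def concordanceVar (n : ℕ) : ℝ :=
  ((n : ℝ) - 1) ^ 3 * (2 * n ^ 3 + 9 * n ^ 2 - 6 * n - 4) / (18 * n ^ 3)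

/-- The fourth moment of half the concordance of two uniform vectors of length `n`. -/
def concordanceFourth (n : ℕ) : ℝ :=
  ((n : ℝ) - 1) ^ 3 *
    (300 * n ^ 10 + 1584 * n ^ 9 - 4113 * n ^ 8 - 17601 * n ^ 7 + 34245 * n ^ 6 + 100773 * n ^ 5
      - 220962 * n ^ 4 - 68040 * n ^ 3 + 359064 * n ^ 2 - 108048 * n - 110016) / (8100 * n ^ 7)

/-- The fraction of non-constant vectors among all vectors. -/
def nonconstFraction (n : ℕ) : ℝ := 1 - n / (n : ℝ) ^ n

theorem self_lt_pow_self {n : ℕ} (hn : 2 ≤ n) : (n : ℝ) < (n : ℝ) ^ n := by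
  have h : (1 : ℝ) < n := by exact_mod_cast hn
  calc (n : ℝ) = (n : ℝ) ^ 1 := (pow_one _).symm
    _ < (n : ℝ) ^ n := pow_lt_pow_right₀ h (by omega)

theorem nonconstFraction_pos {n : ℕ} (hn : 2 ≤ n) : 0 < nonconstFraction n := by
  have h := self_lt_pow_self hn
  have h0 : (0 : ℝ) ≤ n := Nat.cast_nonneg n
  rw [nonconstFraction, sub_pos, div_lt_one (by linarith)]
  exact h

theorem nonconstFraction_le_one (n : ℕ) : nonconstFraction n ≤ 1 := by
  have : (0 : ℝ) ≤ n / (n : ℝ) ^ n := by positivity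
  rw [nonconstFraction]
  linarith

theorem div_pow_self_le {n : ℕ} (hn : 2 ≤ n) : (n : ℝ) / (n : ℝ) ^ n ≤ 1 / n := by
  have h : (1 : ℝ) ≤ n := by exact_mod_cast (by omega : 1 ≤ n)
  have h2 : (n : ℝ) ^ 2 ≤ (n : ℝ) ^ n := pow_le_pow_right₀ h hn
  rw [div_le_div_iff₀ (by positivity) (by positivity)]
  nlinarith

theorem nonconstFraction_le_succ {n : ℕ} (hn : 2 ≤ n) :
    nonconstFraction n ≤ nonconstFraction (n + 1) := by
  have h : ∀ m : ℕ, 1 ≤ m → (m : ℝ) / (m : ℝ) ^ m = ((m : ℝ) ^ (m - 1))⁻¹ := by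
    intro m hm
    obtain ⟨k, rfl⟩ : ∃ k, m = k + 1 := ⟨m - 1, by omega⟩
    have : ((k + 1 : ℕ) : ℝ) ≠ 0 := by positivity
    rw [Nat.add_sub_cancel, pow_succ]
    field_simp
  rw [nonconstFraction, nonconstFraction, h n (by omega), h (n + 1) (by omega)]
  have h1 : (1 : ℝ) ≤ n := by exact_mod_cast (by omega : 1 ≤ n)
  have : (n : ℝ) ^ (n - 1) ≤ ((n + 1 : ℕ) : ℝ) ^ (n + 1 - 1) :=
    calc (n : ℝ) ^ (n - 1) ≤ (n : ℝ) ^ (n + 1 - 1) := pow_le_pow_right₀ h1 (by omega)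
      _ ≤ _ := pow_le_pow_left₀ (by positivity) (by push_cast; linarith) _
  have := inv_anti₀ (by positivity) this
  linarith

theorem tendsto_nonconstFraction : Tendsto nonconstFraction atTop (𝓝 1) := by
  have h : Tendsto (fun n : ℕ => (n : ℝ) / (n : ℝ) ^ n) atTop (𝓝 0) := by
    refine squeeze_zero' (Eventually.of_forall fun n => by positivity) ?_
      tendsto_one_div_atTop_nhds_zero_nat
    filter_upwards [eventually_ge_atTop 2] with n hn using div_pow_self_le hn
  have h1 := h.const_sub 1
  rw [sub_zero] at h1
  exact h1

theorem aemeasurable_kemenyDist {n : ℕ} {Ω : Type*} [MeasurableSpace Ω] {P : Measure Ω}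
    {X Y : Ω → Fin n → Fin n} {D : Ω → ℝ} (hX : AEMeasurable X P) (hY : AEMeasurable Y P)
    (hD : ∀ ω, D ω = kemenyDist (X ω) (Y ω)) : AEMeasurable D P := by
  have h : D = (fun z : (Fin n → Fin n) × (Fin n → Fin n) => kemenyDist z.1 z.2) ∘
      fun ω => (X ω, Y ω) := funext hD
  rw [h]
  exact Measurable.of_discrete.comp_aemeasurable (hX.prodMk hY)

section
variable {n : ℕ} {Ω : Type*} [MeasurableSpace Ω] {P : Measure Ω} [IsProbabilityMeasure P]
  {X Y : Ω → Fin n → Fin n}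

-- The factor is 1/p² because both vectors are conditioned to be non-constant. Real `φ` serves the
-- moments, complex `φ` the characteristic functions.
open scoped BigOperators in
theorem integral_comp_concordance_eq_expect {𝕜 : Type*} [RCLike 𝕜] (hn : 2 ≤ n)
    (hX : HasLaw X (uniformOn (kemenyPopulation n)) P)
    (hY : HasLaw Y (uniformOn (kemenyPopulation n)) P) (hXY : IndepFun X Y P) (φ : ℝ → 𝕜) :
    ∫ ω, φ (concordance (X ω) (Y ω)) ∂P =
      φ 0 + ((nonconstFraction n ^ 2)⁻¹ : ℝ) *
        ((𝔼 x : Fin n → Fin n, 𝔼 y : Fin n → Fin n, φ (concordance x y)) - φ 0) := by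
  have h0 : (n : ℝ) ≠ 0 := by
    have : 0 < n := by omega
    positivity
  have hN : ((n : ℝ) ^ n - n) ≠ 0 := (sub_pos.2 (self_lt_pow_self hn)).ne'
  have hNE : Nonempty (Fin n) := ⟨⟨0, by omega⟩⟩
  have hc : (nonconstFraction n ^ 2)⁻¹ =
      (((n : ℝ) ^ n - n) ^ 2)⁻¹ * ((n : ℝ) ^ n * (n : ℝ) ^ n) := by
    have h1 : nonconstFraction n = ((n : ℝ) ^ n - n) / (n : ℝ) ^ n := by
      rw [nonconstFraction]
      field_simp
    rw [h1, div_pow, inv_div, sq ((n : ℝ) ^ n)]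
    ring
  have hE : (𝔼 x : Fin n → Fin n, 𝔼 y : Fin n → Fin n, φ (concordance x y)) - φ 0 =
      𝔼 x : Fin n → Fin n, 𝔼 y : Fin n → Fin n, (φ (concordance x y) - φ 0) := by
    simp [Finset.expect_sub_distrib]
  have h0' : (n : 𝕜) ≠ 0 := by exact_mod_cast h0
  rw [integral_comp_concordance hn hX hY hXY, hc, hE]
  simp only [Fintype.expect_eq_sum_div_card, ← Finset.sum_div, RCLike.real_smul_eq_coe_mul]
  simp only [Fintype.card_fun, Fintype.card_fin]
  push_cast
  field_simp

theorem integral_concordance_pow (hn : 2 ≤ n)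
    (hX : HasLaw X (uniformOn (kemenyPopulation n)) P)
    (hY : HasLaw Y (uniformOn (kemenyPopulation n)) P) (hXY : IndepFun X Y P) {r : ℕ}
    (hr : r ≠ 0) :
    ∫ ω, concordance (X ω) (Y ω) ^ r ∂P = edgeSum n n r [] / nonconstFraction n ^ 2 := by
  have h := integral_comp_concordance_eq_expect hn hX hY hXY fun t => t ^ r
  rw [h, expect_concordance_pow]
  simp [hr]
  ring

variable {D : Ω → ℝ}

theorem integral_kemenyDist (hn : 2 ≤ n)
    (hX : HasLaw X (uniformOn (kemenyPopulation n)) P)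
    (hY : HasLaw Y (uniformOn (kemenyPopulation n)) P) (hXY : IndepFun X Y P)
    (hD : ∀ ω, D ω = kemenyDist (X ω) (Y ω)) :
    ∫ ω, D ω ∂P = ((n : ℝ) ^ 2 - n) / 2 := by
  have : NeZero n := ⟨by omega⟩
  simp only [hD, kemenyDist_eq]
  have h := integral_comp_concordance_eq_expect hn hX hY hXY
    fun t => ((n : ℝ) ^ 2 - n) / 2 - t / 2
  rw [h]
  simp [Finset.expect_sub_distrib, ← Finset.expect_div, expect_concordance]

theorem centralMoment_kemenyDist (hn : 2 ≤ n)
    (hX : HasLaw X (uniformOn (kemenyPopulation n)) P)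
    (hY : HasLaw Y (uniformOn (kemenyPopulation n)) P) (hXY : IndepFun X Y P)
    (hD : ∀ ω, D ω = kemenyDist (X ω) (Y ω)) {r : ℕ} (hr : Even r) (hr0 : r ≠ 0) :
    centralMoment D r P = edgeSum n n r [] / 2 ^ r / nonconstFraction n ^ 2 := by
  have h : ∀ ω, (D ω - ∫ ω', D ω' ∂P) ^ r = concordance (X ω) (Y ω) ^ r / 2 ^ r := by
    intro ω
    -- The centred distance is -C/2; an even power drops the sign.
    rw [integral_kemenyDist hn hX hY hXY hD, hD, kemenyDist_eq, ← div_pow, ← hr.neg_pow]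
    congr 1
    ring
  simp only [centralMoment, Pi.pow_apply, Pi.sub_apply, h]
  rw [integral_div, integral_concordance_pow hn hX hY hXY hr0]
  ring

theorem variance_kemenyDist (hn : 2 ≤ n)
    (hX : HasLaw X (uniformOn (kemenyPopulation n)) P)
    (hY : HasLaw Y (uniformOn (kemenyPopulation n)) P) (hXY : IndepFun X Y P)
    (hD : ∀ ω, D ω = kemenyDist (X ω) (Y ω)) :
    variance D P = concordanceVar n / nonconstFraction n ^ 2 := by
  have : NeZero n := ⟨by omega⟩
  rw [← centralMoment_two_eq_variance (aemeasurable_kemenyDist hX.aemeasurable hY.aemeasurable hD),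
    centralMoment_kemenyDist hn hX hY hXY hD even_two two_ne_zero, edgeSum_two, concordanceVar]
  ring

theorem excessKurtosis_kemenyDist (hn : 2 ≤ n)
    (hX : HasLaw X (uniformOn (kemenyPopulation n)) P)
    (hY : HasLaw Y (uniformOn (kemenyPopulation n)) P) (hXY : IndepFun X Y P)
    (hD : ∀ ω, D ω = kemenyDist (X ω) (Y ω)) :
    excessKurtosis D P =
      nonconstFraction n ^ 2 * (concordanceFourth n / concordanceVar n ^ 2) - 3 := by
  have : NeZero n := ⟨by omega⟩
  have hp := (nonconstFraction_pos hn).ne'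
  rw [excessKurtosis, variance_kemenyDist hn hX hY hXY hD,
    centralMoment_kemenyDist hn hX hY hXY hD (by decide) (by norm_num),
    show edgeSum n n 4 [] = 16 * concordanceFourth n from edgeSum_four]
  field_simp
  ring

end

/-! ### Sign, monotonicity and limits of the rational functions of n -/

theorem concordanceVar_pos {n : ℕ} (hn : 2 ≤ n) : 0 < concordanceVar n := by
  obtain ⟨k, rfl⟩ := Nat.exists_eq_add_of_le hn
  rw [concordanceVar]
  have h1 : (0 : ℝ) < ((2 + k : ℕ) : ℝ) - 1 := by push_cast; linarith [(Nat.cast_nonneg k : (0:ℝ) ≤ k)]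
  have h2 : (0 : ℝ) < 2 * ((2 + k : ℕ) : ℝ) ^ 3 + 9 * ((2 + k : ℕ) : ℝ) ^ 2 - 6 * ((2 + k : ℕ) : ℝ) - 4 := by
    push_cast
    ring_nf
    positivity
  positivity

theorem kurtosis_eq {n : ℕ} (hn : 2 ≤ n) :
    concordanceFourth n / concordanceVar n ^ 2 =
      (300 * (n : ℝ) ^ 10 + 1584 * n ^ 9 - 4113 * n ^ 8 - 17601 * n ^ 7 + 34245 * n ^ 6
        + 100773 * n ^ 5 - 220962 * n ^ 4 - 68040 * n ^ 3 + 359064 * n ^ 2 - 108048 * n - 110016) /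
      (25 * n * (n - 1) ^ 3 * (2 * n ^ 3 + 9 * n ^ 2 - 6 * n - 4) ^ 2) := by
  have h := concordanceVar_pos hn
  rw [concordanceVar] at h
  have h0 : (n : ℝ) ≠ 0 := by
    have : 0 < n := by omega
    positivity
  have h1 : (n : ℝ) - 1 ≠ 0 := by
    intro h1
    simp [h1] at h
  have h2 : 2 * (n : ℝ) ^ 3 + 9 * n ^ 2 - 6 * n - 4 ≠ 0 := by
    intro h2
    simp [h2] at h
  rw [concordanceFourth, concordanceVar]
  field_simp
  ring

/-- The ratio equals 4 at n = 2, so the bound can only start at 3. After substituting n = 3 + k the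
relevant polynomials in k have no negative coefficients, which is what `positivity` uses. -/
theorem kurtosis_bounds {n : ℕ} (hn : 3 ≤ n) :
    0 < concordanceFourth n / concordanceVar n ^ 2 ∧
      concordanceFourth n / concordanceVar n ^ 2 < 3 := by
  rw [kurtosis_eq (by omega)]
  obtain ⟨k, rfl⟩ := Nat.exists_eq_add_of_le hn
  have hk : (0 : ℝ) ≤ k := Nat.cast_nonneg k
  have hden : (0 : ℝ) < 25 * ((3 + k : ℕ) : ℝ) * (((3 + k : ℕ) : ℝ) - 1) ^ 3 *
      (2 * ((3 + k : ℕ) : ℝ) ^ 3 + 9 * ((3 + k : ℕ) : ℝ) ^ 2 - 6 * ((3 + k : ℕ) : ℝ) - 4) ^ 2 := by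
    push_cast
    ring_nf
    positivity
  constructor
  · refine div_pos ?_ hden
    push_cast
    ring_nf
    positivity
  · rw [div_lt_iff₀ hden, ← sub_pos]
    push_cast
    ring_nf
    positivity

theorem kurtosis_lt_succ {n : ℕ} (hn : 3 ≤ n) :
    concordanceFourth n / concordanceVar n ^ 2 <
      concordanceFourth (n + 1) / concordanceVar (n + 1) ^ 2 := by
  rw [kurtosis_eq (by omega), kurtosis_eq (by omega)]
  obtain ⟨k, rfl⟩ := Nat.exists_eq_add_of_le hn
  have hk : (0 : ℝ) ≤ k := Nat.cast_nonneg k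
  rw [div_lt_div_iff₀, ← sub_pos] <;>
  · push_cast
    ring_nf
    positivity

theorem tendsto_kurtosis :
    Tendsto (fun n => concordanceFourth n / concordanceVar n ^ 2) atTop (𝓝 3) := by
  -- The ratio in u = 1/n: numerator and denominator, both of degree 10, are divided by n¹⁰. At u =
  -- 0 it is 300/100.
  let f : ℝ → ℝ := fun u =>
    (300 + 1584 * u - 4113 * u ^ 2 - 17601 * u ^ 3 + 34245 * u ^ 4 + 100773 * u ^ 5
      - 220962 * u ^ 6 - 68040 * u ^ 7 + 359064 * u ^ 8 - 108048 * u ^ 9 - 110016 * u ^ 10) /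
    (25 * (1 - u) ^ 3 * (2 + 9 * u - 6 * u ^ 2 - 4 * u ^ 3) ^ 2)
  have hf : ContinuousAt f 0 := by
    refine ContinuousAt.div (by fun_prop) (by fun_prop) (by norm_num)
  have h := hf.tendsto.comp tendsto_one_div_atTop_nhds_zero_nat
  have h0 : f 0 = 3 := by norm_num [f]
  rw [h0] at h
  refine h.congr' ?_
  filter_upwards [eventually_ge_atTop 2] with n hn
  have hn0 : (n : ℝ) ≠ 0 := by
    have : 0 < n := by omega
    positivity
  rw [kurtosis_eq hn]
  simp only [Function.comp, f]
  rw [← mul_div_mul_right _ _ (pow_ne_zero 10 hn0)]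
  congr 1 <;> field_simp

theorem tendsto_concordanceVar_div :
    Tendsto (fun n : ℕ => concordanceVar n / (n : ℝ) ^ 3) atTop (𝓝 (1 / 9)) := by
  let f : ℝ → ℝ := fun u => (1 - u) ^ 3 * (2 + 9 * u - 6 * u ^ 2 - 4 * u ^ 3) / 18
  have hf : Continuous f := by fun_prop
  have h := (hf.tendsto 0).comp tendsto_one_div_atTop_nhds_zero_nat
  have h0 : f 0 = 1 / 9 := by norm_num [f]
  rw [h0] at h
  refine h.congr' ?_
  filter_upwards [eventually_ge_atTop 2] with n hn
  have hn0 : (n : ℝ) ≠ 0 := by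
    have : 0 < n := by omega
    positivity
  simp only [Function.comp, f, concordanceVar]
  field_simp

theorem tendsto_kemenyPopVariance_div :
    Tendsto (fun n : ℕ => kemenyPopVariance n / (n : ℝ) ^ 3) atTop (𝓝 (1 / 9)) := by
  let f : ℝ → ℝ := fun u => (1 - u) ^ 2 * (1 + 4 * u) * (2 - u) / 18
  have hf : Continuous f := by fun_prop
  have h := (hf.tendsto 0).comp tendsto_one_div_atTop_nhds_zero_nat
  have h0 : f 0 = 1 / 9 := by norm_num [f]
  rw [h0] at h
  refine h.congr' ?_
  filter_upwards [eventually_ge_atTop 2] with n hn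
  have hn0 : (n : ℝ) ≠ 0 := by
    have : 0 < n := by omega
    positivity
  simp only [Function.comp, f, kemenyPopVariance]
  field_simp

/-- The excess kurtosis of the Kemeny distance, as a function of `n`. -/
def kemenyKurtosis (n : ℕ) : ℝ :=
  nonconstFraction n ^ 2 * (concordanceFourth n / concordanceVar n ^ 2) - 3

theorem kemenyKurtosis_two : kemenyKurtosis 2 = -2 := by
  norm_num [kemenyKurtosis, nonconstFraction, concordanceFourth, concordanceVar]

theorem kemenyKurtosis_neg {n : ℕ} (hn : 2 ≤ n) : kemenyKurtosis n < 0 := by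
  rcases hn.eq_or_lt with rfl | hn3
  · rw [kemenyKurtosis_two]
    norm_num
  · obtain ⟨h0, h3⟩ := kurtosis_bounds hn3
    have hp := nonconstFraction_pos hn
    have hp1 : nonconstFraction n ^ 2 ≤ 1 := pow_le_one₀ hp.le (nonconstFraction_le_one n)
    rw [kemenyKurtosis]
    nlinarith

theorem kemenyKurtosis_lt_succ {n : ℕ} (hn : 2 ≤ n) :
    kemenyKurtosis n < kemenyKurtosis (n + 1) := by
  rcases hn.eq_or_lt with rfl | hn3
  -- At n = 2 the two factors move in opposite directions (the ratio is 4 at 2 and below 3 at 3), so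
  -- the values are compared directly.
  · norm_num [kemenyKurtosis, nonconstFraction, concordanceFourth, concordanceVar]
  · have hp := nonconstFraction_pos hn
    have hle := nonconstFraction_le_succ hn
    have h0 := (kurtosis_bounds hn3).1
    rw [kemenyKurtosis, kemenyKurtosis]
    refine sub_lt_sub_right (mul_lt_mul' (pow_le_pow_left₀ hp.le hle 2) (kurtosis_lt_succ hn3)
      h0.le (pow_pos (hp.trans_le hle) 2)) 3

theorem tendsto_kemenyKurtosis : Tendsto kemenyKurtosis atTop (𝓝 0) := by
  have h := ((tendsto_nonconstFraction.pow 2).mul tendsto_kurtosis).sub_const 3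
  norm_num at h
  exact h

end

/-! ### Asymptotic normality -/

noncomputable section
open scoped BigOperators

/-- The centred and scaled value `𝔼_c sign (a - c)`. -/
def centredRank {q : ℕ} (a : Fin q) : ℝ := (2 * a - q + 1) / q

/-- The projection of the concordance to sums of functions of single items. -/
def concordanceProj {n : ℕ} (x y : Fin n → Fin n) : ℝ :=
  2 * ((n : ℝ) - 1) * ∑ j, centredRank (x j) * centredRank (y j)

section
variable {n q : ℕ} [NeZero q]

theorem expect_apply_pi (k : Fin n) (F : Fin q → ℝ) :
    𝔼 x : Fin n → Fin q, F (x k) = 𝔼 a : Fin q, F a := by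
  have h := expect_comp_injective (β := Fin q) ![k] (Function.injective_of_subsingleton _)
    fun y => F (y 0)
  simpa [expect_vecCons] using h

theorem expect_apply_pi_pair {k l : Fin n} (hkl : k ≠ l) (F : Fin q → Fin q → ℝ) :
    𝔼 x : Fin n → Fin q, F (x k) (x l) = 𝔼 a : Fin q, 𝔼 b : Fin q, F a b := by
  have hinj : Function.Injective ![k, l] := by
    intro i j hij
    fin_cases i <;> fin_cases j <;> simp_all
  have h := expect_comp_injective (β := Fin q) ![k, l] hinj fun y => F (y 0) (y 1)
  simpa [expect_vecCons] using h

theorem expect_centredRank_sq :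
    𝔼 a : Fin q, centredRank a * centredRank a = ((q : ℝ) ^ 2 - 1) / (3 * q ^ 2) :=
  expect_centred_sq

theorem expect_centredRank : 𝔼 a : Fin q, centredRank a = 0 := expect_centred

theorem expect_centredRank_mul (j k : Fin n) :
    𝔼 x : Fin n → Fin q, centredRank (x j) * centredRank (x k) =
      if j = k then ((q : ℝ) ^ 2 - 1) / (3 * q ^ 2) else 0 := by
  split_ifs with h
  · subst h
    rw [expect_apply_pi j fun a => centredRank a * centredRank a, expect_centredRank_sq]
  · rw [expect_apply_pi_pair h fun a b => centredRank a * centredRank b]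
    simp only [← Finset.mul_expect, expect_centredRank, mul_zero, Finset.expect_const_zero]

/-- A vertex j off the edge gives 0 by exchanging k and l. The two end points give opposite values,
whose sign cancels when the x and y averages are multiplied. -/
theorem expect_ordSign_mul_centredRank {k l : Fin n} (hkl : k ≠ l) (j : Fin n) :
    𝔼 x : Fin n → Fin q, ordSign (x k) (x l) * centredRank (x j) =
      (if j = k then ((q : ℝ) ^ 2 - 1) / (3 * q ^ 2) else 0) -
        if j = l then ((q : ℝ) ^ 2 - 1) / (3 * q ^ 2) else 0 := by
  have hk : 𝔼 a : Fin q, 𝔼 b : Fin q, ordSign a b * centredRank a =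
      ((q : ℝ) ^ 2 - 1) / (3 * q ^ 2) := by
    simp only [← Finset.expect_mul, expect_ordSign]
    exact expect_centred_sq
  by_cases hjk : j = k
  · subst hjk
    rw [expect_apply_pi_pair hkl fun a b => ordSign a b * centredRank a, hk]
    simp [hkl]
  · by_cases hjl : j = l
    · subst hjl
      rw [expect_apply_pi_pair hkl fun a b => ordSign a b * centredRank b, Finset.expect_comm,
        ← hk, if_neg hjk, if_pos rfl, zero_sub, ← Finset.expect_neg_distrib]
      refine Finset.expect_congr rfl fun b _ => ?_
      rw [← Finset.expect_neg_distrib]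
      refine Finset.expect_congr rfl fun a _ => ?_
      rw [ordSign_swap b a]
      ring
    · rw [if_neg hjk, if_neg hjl, sub_zero]
      have h := expect_comp_injective (β := Fin q) (Equiv.swap k l) (Equiv.injective _)
        fun x : Fin n → Fin q => ordSign (x k) (x l) * centredRank (x j)
      simp only [Function.comp, Equiv.swap_apply_left, Equiv.swap_apply_right,
        Equiv.swap_apply_of_ne_of_ne hjk hjl] at h
      rw [Finset.expect_congr rfl fun x _ => show
        ordSign (x l) (x k) * centredRank (x j) = -(ordSign (x k) (x l) * centredRank (x j)) by
          rw [ordSign_swap (x k) (x l)]; ring, Finset.expect_neg_distrib] at h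
      linarith

end

section
variable {n : ℕ} [NeZero n]

theorem expect_concordanceProj_sq :
    𝔼 x : Fin n → Fin n, 𝔼 y : Fin n → Fin n, concordanceProj x y ^ 2 =
      4 * n * ((n : ℝ) - 1) ^ 2 * (((n : ℝ) ^ 2 - 1) / (3 * n ^ 2)) ^ 2 := by
  have h : ∀ x y : Fin n → Fin n, concordanceProj x y ^ 2 = ∑ j, ∑ k, 4 * ((n : ℝ) - 1) ^ 2 *
      ((centredRank (x j) * centredRank (x k)) * (centredRank (y j) * centredRank (y k))) := by
    intro x y
    simp only [← Finset.mul_sum]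
    rw [concordanceProj, mul_pow, sq (∑ j, _), Finset.sum_mul_sum]
    congr 1
    · ring
    · exact Finset.sum_congr rfl fun j _ => Finset.sum_congr rfl fun k _ => by ring
  simp only [h, Finset.expect_sum_comm, ← Finset.mul_expect, ← Finset.expect_mul,
    expect_centredRank_mul]
  simp
  ring

/-- Same value as `expect_concordanceProj_sq`: the remainder is orthogonal to the projection, so its
mean square is a difference of second moments. -/
theorem expect_concordance_mul_concordanceProj :
    𝔼 x : Fin n → Fin n, 𝔼 y : Fin n → Fin n, concordance x y * concordanceProj x y =
      4 * n * ((n : ℝ) - 1) ^ 2 * (((n : ℝ) ^ 2 - 1) / (3 * n ^ 2)) ^ 2 := by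
  have h : ∀ x y : Fin n → Fin n, concordance x y * concordanceProj x y =
      ∑ k, ∑ l, ∑ j, 2 * ((n : ℝ) - 1) * ((ordSign (x k) (x l) * centredRank (x j)) *
        (ordSign (y k) (y l) * centredRank (y j))) := by
    intro x y
    simp only [← Finset.mul_sum]
    rw [concordance, concordanceProj, ← mul_assoc, mul_comm (∑ k, _) (2 * _), mul_assoc,
      Finset.sum_mul]
    congr 1
    refine Finset.sum_congr rfl fun k _ => ?_
    rw [Finset.sum_mul]
    refine Finset.sum_congr rfl fun l _ => ?_
    rw [Finset.mul_sum]
    exact Finset.sum_congr rfl fun j _ => by ring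
  set B : ℝ := ((n : ℝ) ^ 2 - 1) / (3 * n ^ 2) with hB
  have hkl : ∀ k l j : Fin n, (𝔼 x : Fin n → Fin n, ordSign (x k) (x l) * centredRank (x j)) *
      (𝔼 y : Fin n → Fin n, ordSign (y k) (y l) * centredRank (y j)) =
      (if j = k then (1 - if k = l then 1 else 0) * B ^ 2 else 0) +
        if j = l then (1 - if k = l then 1 else 0) * B ^ 2 else 0 := by
    intro k l j
    by_cases h : k = l
    · subst h
      simp [ordSign_self]
    · rw [expect_ordSign_mul_centredRank h]
      by_cases h1 : j = k
      · subst h1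
        simp [h]
        ring
      · simp [h1, h]
        split_ifs <;> ring
  simp only [h, Finset.expect_sum_comm, ← Finset.mul_expect, ← Finset.expect_mul, hkl]
  simp only [← Finset.mul_sum, Finset.sum_add_distrib, Finset.sum_ite_eq', Finset.mem_univ, if_true,
    ← Finset.sum_mul, Finset.sum_sub_distrib, Finset.sum_ite_eq]
  simp
  ring

theorem expect_sq_concordance_sub_proj_le :
    𝔼 x : Fin n → Fin n, 𝔼 y : Fin n → Fin n, (concordance x y - concordanceProj x y) ^ 2 ≤
      2 * (n : ℝ) ^ 2 := by
  have hn := cast_ne_zero_of_neZero (q := n)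
  have h : ∀ x y : Fin n → Fin n, (concordance x y - concordanceProj x y) ^ 2 =
      concordance x y ^ 2 - 2 * (concordance x y * concordanceProj x y) +
        concordanceProj x y ^ 2 := fun x y => by ring
  simp only [h, Finset.expect_add_distrib, Finset.expect_sub_distrib, ← Finset.mul_expect]
  rw [expect_concordance_pow, expect_concordance_mul_concordanceProj, expect_concordanceProj_sq,
    edgeSum_two]
  have h1 : (1 : ℝ) ≤ n := by exact_mod_cast NeZero.one_le
  have hk : (0 : ℝ) ≤ n * ((n : ℝ) - 1) * (((n : ℝ) ^ 2 - 1) / (3 * n ^ 2)) ^ 2 :=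
    mul_nonneg (mul_nonneg (by linarith) (by linarith)) (sq_nonneg _)
  -- The n³ terms cancel, leaving the contribution of doubled edges minus a nonnegative term.
  have h2 : 4 * (((n : ℝ) - 1) ^ 3 * (2 * n ^ 3 + 9 * n ^ 2 - 6 * n - 4) / (18 * n ^ 3)) -
      2 * (4 * n * ((n : ℝ) - 1) ^ 2 * (((n : ℝ) ^ 2 - 1) / (3 * n ^ 2)) ^ 2) +
      4 * n * ((n : ℝ) - 1) ^ 2 * (((n : ℝ) ^ 2 - 1) / (3 * n ^ 2)) ^ 2 =
      2 * (((n : ℝ) - 1) ^ 3 / n) -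
        4 * (n * ((n : ℝ) - 1) * (((n : ℝ) ^ 2 - 1) / (3 * n ^ 2)) ^ 2) := by
    field_simp
    ring
  have h3 : ((n : ℝ) - 1) ^ 3 / n ≤ n ^ 2 := by
    rw [div_le_iff₀ (by linarith), ← pow_succ]
    exact pow_le_pow_left₀ (by linarith) (by linarith) 3
  rw [h2]
  linarith

theorem expect_abs_concordance_sub_proj_le :
    𝔼 x : Fin n → Fin n, 𝔼 y : Fin n → Fin n, |concordance x y - concordanceProj x y| ≤
      3 / 2 * (n : ℝ) := by
  have hn0 : (0 : ℝ) < n := by exact_mod_cast NeZero.pos n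
  -- AM-GM in place of Cauchy–Schwarz; the weight n balances the mean square bound 2n².
  have hpt : ∀ z : ℝ, |z| ≤ z ^ 2 * (1 / (2 * n)) + n / 2 := by
    intro z
    have h1 : 0 ≤ (|z| - n) ^ 2 := sq_nonneg _
    have h2 : z ^ 2 * (1 / (2 * n)) + n / 2 - |z| = (|z| - n) ^ 2 * (1 / (2 * n)) := by
      rw [sub_sq, sq_abs]
      field_simp
      ring
    have : 0 ≤ (|z| - n) ^ 2 * (1 / (2 * n)) := by positivity
    linarith
  calc 𝔼 x : Fin n → Fin n, 𝔼 y : Fin n → Fin n, |concordance x y - concordanceProj x y|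
      ≤ 𝔼 x : Fin n → Fin n, 𝔼 y : Fin n → Fin n,
        ((concordance x y - concordanceProj x y) ^ 2 * (1 / (2 * n)) + n / 2) :=
        Finset.expect_le_expect fun x _ => Finset.expect_le_expect fun y _ => hpt _
    _ = (𝔼 x : Fin n → Fin n, 𝔼 y : Fin n → Fin n,
        (concordance x y - concordanceProj x y) ^ 2) * (1 / (2 * n)) + n / 2 := by
        simp only [Finset.expect_add_distrib, ← Finset.expect_mul, Fintype.expect_const]
    _ ≤ 2 * (n : ℝ) ^ 2 * (1 / (2 * n)) + n / 2 := by
        have := expect_sq_concordance_sub_proj_le (n := n)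
        gcongr
    _ = 3 / 2 * (n : ℝ) := by
        field_simp
        ring

end

end

/-! ### Characteristic functions and the central limit theorem -/

noncomputable section
open scoped BigOperators

theorem expect_prod_apply {n : ℕ} {α β : Type*} [Fintype α] [Fintype β]
    [DecidableEq α] [DecidableEq β] (h : α → β → ℂ) :
    𝔼 x : Fin n → α, 𝔼 y : Fin n → β, ∏ k, h (x k) (y k) = (𝔼 a : α, 𝔼 b : β, h a b) ^ n := by
  have h1 : 𝔼 a : α, 𝔼 b : β, h a b = 𝔼 z : α × β, h z.1 z.2 := by
    rw [← Finset.univ_product_univ, Finset.expect_product]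
  rw [h1, Finset.expect_pow, Fintype.piFinset_univ,
    Fintype.expect_equiv (Equiv.arrowProdEquivProdArrow (Fin n) (fun _ => α) fun _ => β)
      (fun p : Fin n → α × β => ∏ i, h (p i).1 (p i).2)
      (fun z : (Fin n → α) × (Fin n → β) => ∏ i, h (z.1 i) (z.2 i)) (fun p => rfl),
    ← Finset.univ_product_univ, Finset.expect_product]

theorem abs_centredRank_le_one {q : ℕ} (a : Fin q) : |centredRank a| ≤ 1 := by
  have h : ((a : ℕ) : ℝ) + 1 ≤ q := by exact_mod_cast a.2
  have h0 : (0 : ℝ) ≤ (a : ℕ) := Nat.cast_nonneg _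
  rw [centredRank, abs_div, abs_of_pos (show (0 : ℝ) < q by linarith),
    div_le_one (by linarith), abs_le]
  constructor <;> linarith

theorem norm_expect_exp_sub_le {q : ℕ} [NeZero q] {s : ℝ} (hs : |s| ≤ 1) :
    ‖(𝔼 a : Fin q, 𝔼 b : Fin q,
        Complex.exp (Complex.I * ((s * (centredRank a * centredRank b) : ℝ) : ℂ))) -
      (1 - ((s ^ 2 * (((q : ℝ) ^ 2 - 1) / (3 * q ^ 2)) ^ 2 / 2 : ℝ) : ℂ))‖ ≤ |s| ^ 3 := by
  -- Average of the second-order Taylor polynomial: the linear term drops out because `centredRank`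
  -- has mean 0.
  have hmean : 𝔼 a : Fin q, 𝔼 b : Fin q, (1 + Complex.I * (s * (centredRank a * centredRank b)) -
      (s ^ 2 / 2) * ((centredRank a * centredRank a) * (centredRank b * centredRank b))) =
      (1 - ((s ^ 2 * (((q : ℝ) ^ 2 - 1) / (3 * q ^ 2)) ^ 2 / 2 : ℝ) : ℂ)) := by
    have h1 : 𝔼 a : Fin q, (centredRank a : ℂ) = 0 := by
      have := congrArg (Complex.ofReal) (expect_centredRank (q := q))
      simpa [Fintype.expect_eq_sum_div_card] using this
    have h2 : 𝔼 a : Fin q, (centredRank a * centredRank a : ℂ) =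
        ((((q : ℝ) ^ 2 - 1) / (3 * q ^ 2) : ℝ) : ℂ) := by
      have := congrArg (Complex.ofReal) (expect_centredRank_sq (q := q))
      simpa [Fintype.expect_eq_sum_div_card] using this
    simp only [Finset.expect_sub_distrib, Finset.expect_add_distrib, ← Finset.mul_expect,
      ← Finset.expect_mul, h1, h2, Fintype.expect_const, mul_zero]
    push_cast
    ring
  rw [← hmean]
  simp only [← Finset.expect_sub_distrib]
  refine (RCLike.norm_expect_le (K := ℂ)).trans (Finset.expect_le Finset.univ_nonempty fun a _ =>
    (RCLike.norm_expect_le (K := ℂ)).trans (Finset.expect_le Finset.univ_nonempty fun b _ => ?_))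
  set u : ℝ := s * (centredRank a * centredRank b) with hu
  have hus : |u| ≤ |s| := by
    rw [hu, abs_mul, abs_mul]
    have := mul_le_one₀ (abs_centredRank_le_one a) (abs_nonneg _) (abs_centredRank_le_one b)
    nlinarith [abs_nonneg s]
  have hnorm : ‖Complex.I * (u : ℂ)‖ = |u| := by simp
  have hb := Complex.exp_bound (x := Complex.I * u) (by rw [hnorm]; linarith)
    (n := 3) (by norm_num)
  rw [hnorm] at hb
  simp only [Finset.sum_range_succ, Finset.sum_range_zero, Nat.factorial] at hb
  have hI : Complex.I ^ 2 = -1 := Complex.I_sq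
  have heq : Complex.exp (Complex.I * (u : ℂ)) -
      (1 + Complex.I * (s * (centredRank a * centredRank b)) -
        (s ^ 2 / 2) * ((centredRank a * centredRank a) * (centredRank b * centredRank b))) =
      Complex.exp (Complex.I * (u : ℂ)) - (0 + (Complex.I * (u : ℂ)) ^ 0 / (1 : ℕ) +
        (Complex.I * (u : ℂ)) ^ 1 / ((0 + 1) * 1 : ℕ) +
        (Complex.I * (u : ℂ)) ^ 2 / ((1 + 1) * ((0 + 1) * 1) : ℕ)) := by
    rw [hu]
    push_cast
    linear_combination ((s ^ 2 / 2) * ((centredRank a * centredRank a) *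
      (centredRank b * centredRank b)) : ℂ) * hI
  rw [heq]
  refine hb.trans ?_
  have h3 : |u| ^ 3 ≤ |s| ^ 3 := pow_le_pow_left₀ (abs_nonneg u) hus 3
  have : (0 : ℝ) ≤ |u| ^ 3 := by positivity
  norm_num
  linarith

theorem expect_exp_concordanceProj {n : ℕ} (θ : ℝ) :
    𝔼 x : Fin n → Fin n, 𝔼 y : Fin n → Fin n,
      Complex.exp (Complex.I * ((θ * concordanceProj x y : ℝ) : ℂ)) =
    (𝔼 a : Fin n, 𝔼 b : Fin n, Complex.exp (Complex.I *
      ((θ * (2 * ((n : ℝ) - 1)) * (centredRank a * centredRank b) : ℝ) : ℂ))) ^ n := by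
  rw [← expect_prod_apply]
  refine Finset.expect_congr rfl fun x _ => Finset.expect_congr rfl fun y _ => ?_
  rw [← Complex.exp_sum]
  congr 1
  rw [concordanceProj, ← Finset.mul_sum, ← Complex.ofReal_sum, ← Finset.mul_sum]
  congr 2
  ring

theorem norm_exp_I_mul_sub_le (a b : ℝ) :
    ‖Complex.exp (Complex.I * (a : ℂ)) - Complex.exp (Complex.I * (b : ℂ))‖ ≤ |a - b| := by
  have h : Complex.exp (Complex.I * (a : ℂ)) - Complex.exp (Complex.I * (b : ℂ)) =
      Complex.exp (Complex.I * (b : ℂ)) * (Complex.exp (Complex.I * ((a - b : ℝ) : ℂ)) - 1) := by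
    rw [mul_sub, ← Complex.exp_add]
    push_cast
    congr 2 <;> ring
  rw [h, norm_mul, mul_comm Complex.I (b : ℂ), Complex.norm_exp_ofReal_mul_I, one_mul]
  exact Real.norm_exp_I_mul_ofReal_sub_one_le

theorem norm_expect_exp_concordance_sub_le {n : ℕ} [NeZero n] (θ : ℝ) :
    ‖(𝔼 x : Fin n → Fin n, 𝔼 y : Fin n → Fin n,
        Complex.exp (Complex.I * ((θ * concordance x y : ℝ) : ℂ))) -
      𝔼 x : Fin n → Fin n, 𝔼 y : Fin n → Fin n,
        Complex.exp (Complex.I * ((θ * concordanceProj x y : ℝ) : ℂ))‖ ≤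
      |θ| * (3 / 2 * n) := by
  simp only [← Finset.expect_sub_distrib]
  calc _ ≤ 𝔼 x : Fin n → Fin n, 𝔼 y : Fin n → Fin n,
        |θ| * |concordance x y - concordanceProj x y| := by
        refine (RCLike.norm_expect_le (K := ℂ)).trans (Finset.expect_le_expect fun x _ =>
          (RCLike.norm_expect_le (K := ℂ)).trans (Finset.expect_le_expect fun y _ => ?_))
        rw [← abs_mul, mul_sub]
        exact norm_exp_I_mul_sub_le _ _
    _ = |θ| * 𝔼 x : Fin n → Fin n, 𝔼 y : Fin n → Fin n,
        |concordance x y - concordanceProj x y| := by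
        simp only [← Finset.mul_expect]
    _ ≤ _ := by
        have := expect_abs_concordance_sub_proj_le (n := n)
        gcongr

theorem tendsto_zero_of_tendsto_sq {f : ℕ → ℝ} (h : Tendsto (fun n => f n ^ 2) atTop (𝓝 0)) :
    Tendsto f atTop (𝓝 0) := by
  rw [tendsto_zero_iff_abs_tendsto_zero]
  have := h.sqrt
  rw [Real.sqrt_zero] at this
  exact this.congr fun n => Real.sqrt_sq_eq_abs _

/-- Convergence of the characteristic functions of the normalised concordance. -/
theorem tendsto_expect_exp_concordance {σ : ℕ → ℝ}
    (hσ : Tendsto (fun n : ℕ => σ n ^ 2 / (n : ℝ) ^ 3) atTop (𝓝 (1 / 9))) (t : ℝ) :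
    Tendsto (fun n : ℕ => 𝔼 x : Fin n → Fin n, 𝔼 y : Fin n → Fin n,
      Complex.exp (Complex.I * ((-t / (2 * σ n) * concordance x y : ℝ) : ℂ))) atTop
      (𝓝 (Complex.exp (-(t : ℂ) ^ 2 / 2))) := by
  have hw : Tendsto (fun n : ℕ => (n : ℝ) ^ 3 / σ n ^ 2) atTop (𝓝 9) := by
    have := hσ.inv₀ (by norm_num)
    simpa using this
  have hinv : Tendsto (fun n : ℕ => 1 / (n : ℝ)) atTop (𝓝 0) := tendsto_one_div_atTop_nhds_zero_nat
  have hpred : Tendsto (fun n : ℕ => 1 - 1 / (n : ℝ)) atTop (𝓝 1) := by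
    simpa using hinv.const_sub 1
  -- Coefficient of each independent summand of the projection; -t/(2σ) comes from the centred
  -- distance being -C/2.
  let s : ℕ → ℝ := fun n => -t / (2 * σ n) * (2 * ((n : ℝ) - 1))
  let B : ℕ → ℝ := fun n => ((n : ℝ) ^ 2 - 1) / (3 * n ^ 2)
  have hB : Tendsto B atTop (𝓝 (1 / 3)) := by
    have h : Tendsto (fun n : ℕ => (1 - (1 / (n : ℝ)) ^ 2) / 3) atTop (𝓝 (1 / 3)) := by
      have := ((hinv.pow 2).const_sub 1).div_const 3
      simpa using this
    refine h.congr' ?_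
    filter_upwards [eventually_ne_atTop 0] with n hn
    have : (n : ℝ) ≠ 0 := Nat.cast_ne_zero.2 hn
    simp only [B]
    field_simp
  -- The sign of σ is not known, so limits are taken for squares. Here 9 is the inverse of 1/9, and
  -- with B → 1/3 it yields n(f - 1) → -9t²·(1/9)/2 = -t²/2.
  have hns : Tendsto (fun n : ℕ => (n : ℝ) * s n ^ 2) atTop (𝓝 (9 * t ^ 2)) := by
    have h := ((hw.mul (hpred.pow 2)).mul_const (t ^ 2))
    rw [one_pow, mul_one] at h
    refine h.congr' ?_
    filter_upwards [eventually_ne_atTop 0] with n hn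
    have : (n : ℝ) ≠ 0 := Nat.cast_ne_zero.2 hn
    simp only [s]
    rw [mul_pow (-t / _), div_pow, mul_pow 2 (σ n)]
    field_simp
  have hs2 : Tendsto (fun n : ℕ => s n ^ 2) atTop (𝓝 0) := by
    have h := hns.mul hinv
    rw [mul_zero] at h
    refine h.congr' ?_
    filter_upwards [eventually_ne_atTop 0] with n hn
    have : (n : ℝ) ≠ 0 := Nat.cast_ne_zero.2 hn
    field_simp
  have hs : Tendsto (fun n => |s n|) atTop (𝓝 0) :=
    (tendsto_zero_iff_abs_tendsto_zero _).1 (tendsto_zero_of_tendsto_sq hs2)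
  let f : ℕ → ℂ := fun n => 𝔼 a : Fin n, 𝔼 b : Fin n,
    Complex.exp (Complex.I * ((s n * (centredRank a * centredRank b) : ℝ) : ℂ))
  have hf : Tendsto (fun n : ℕ => (n : ℂ) * (f n - 1)) atTop (𝓝 (-(t : ℂ) ^ 2 / 2)) := by
    have hmain : Tendsto (fun n : ℕ => (((-(n * s n ^ 2) * B n ^ 2 / 2 : ℝ)) : ℂ)) atTop
        (𝓝 (-(t : ℂ) ^ 2 / 2)) := by
      have h := ((hns.neg.mul (hB.pow 2)).div_const 2)
      have h' := (Complex.continuous_ofReal.tendsto _).comp h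
      have he : -(t : ℂ) ^ 2 / 2 = ((-(9 * t ^ 2) * (1 / 3) ^ 2 / 2 : ℝ) : ℂ) := by
        push_cast
        ring
      rw [he]
      exact h'
    have herr : Tendsto (fun n : ℕ => (n : ℂ) * (f n - 1) -
        (((-(n * s n ^ 2) * B n ^ 2 / 2 : ℝ)) : ℂ)) atTop (𝓝 0) := by
      have hb : Tendsto (fun n : ℕ => (n : ℝ) * s n ^ 2 * |s n|) atTop (𝓝 0) := by
        simpa using hns.mul hs
      refine squeeze_zero_norm' ?_ hb
      filter_upwards [eventually_ne_atTop 0, hs.eventually_le_const (show (0 : ℝ) < 1 by norm_num)]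
        with n hn hsn
      have : NeZero n := ⟨hn⟩
      have hle := norm_expect_exp_sub_le (q := n) hsn
      have heq : (n : ℂ) * (f n - 1) - (((-(n * s n ^ 2) * B n ^ 2 / 2 : ℝ)) : ℂ) =
          n * (f n - (1 - ((s n ^ 2 * B n ^ 2 / 2 : ℝ) : ℂ))) := by
        push_cast
        ring
      rw [heq, norm_mul, Complex.norm_natCast]
      calc (n : ℝ) * ‖f n - (1 - ((s n ^ 2 * B n ^ 2 / 2 : ℝ) : ℂ))‖ ≤ n * |s n| ^ 3 := by
            gcongr
        _ = (n : ℝ) * s n ^ 2 * |s n| := by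
            rw [← sq_abs (s n)]
            ring
    simpa using herr.add hmain
  have hpow : Tendsto (fun n : ℕ => f n ^ n) atTop (𝓝 (Complex.exp (-(t : ℂ) ^ 2 / 2))) := by
    have h := Complex.tendsto_one_add_pow_exp_of_tendsto hf
    simpa using h
  have hdiff : Tendsto (fun n : ℕ => (𝔼 x : Fin n → Fin n, 𝔼 y : Fin n → Fin n,
      Complex.exp (Complex.I * ((-t / (2 * σ n) * concordance x y : ℝ) : ℂ))) - f n ^ n) atTop
      (𝓝 0) := by
    -- The projection error has order n / n^(3/2).
    have hb : Tendsto (fun n : ℕ => |-t / (2 * σ n)| * (3 / 2 * (n : ℝ))) atTop (𝓝 0) := by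
      have h2 : Tendsto (fun n : ℕ => (-t / (2 * σ n) * (3 / 2 * (n : ℝ))) ^ 2) atTop (𝓝 0) := by
        have h := (hw.mul hinv).mul_const (9 / 16 * t ^ 2)
        rw [mul_zero, zero_mul] at h
        refine h.congr' ?_
        filter_upwards [eventually_ne_atTop 0] with n hn
        have : (n : ℝ) ≠ 0 := Nat.cast_ne_zero.2 hn
        rw [mul_pow (-t / _), div_pow, mul_pow 2 (σ n)]
        field_simp
        ring
      have := (tendsto_zero_iff_abs_tendsto_zero _).1 (tendsto_zero_of_tendsto_sq h2)
      refine this.congr fun n => ?_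
      simp only [Function.comp]
      rw [abs_mul, abs_of_nonneg (show (0 : ℝ) ≤ 3 / 2 * n by positivity)]
    refine squeeze_zero_norm' ?_ hb
    filter_upwards [eventually_ne_atTop 0] with n hn
    have : NeZero n := ⟨hn⟩
    have h := norm_expect_exp_concordance_sub_le (n := n) (-t / (2 * σ n))
    rwa [expect_exp_concordanceProj] at h
  simpa using hdiff.add hpow

/-- `TendstoInDistribution` asks for measurability at every n. For n < 2 no law is assumed, but the
target has at most one point. -/
theorem aemeasurable_of_hasLaw_kemenyPopulation {n : ℕ} {Ω : Type*} [MeasurableSpace Ω]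
    {P : Measure Ω} {X : Ω → Fin n → Fin n}
    (hX : 2 ≤ n → HasLaw X (uniformOn (kemenyPopulation n)) P) : AEMeasurable X P := by
  by_cases hn : 2 ≤ n
  · exact (hX hn).aemeasurable
  · have : Subsingleton (Fin n) := Fin.subsingleton_iff_le_one.2 (by omega)
    exact (measurable_of_subsingleton_codomain X).aemeasurable

/-- Only σ² ~ n³/9 matters, so the exact and the closed-form scalings are both instances. -/
theorem tendstoInDistribution_kemenyDist {Ω : ℕ → Type*} [∀ n, MeasurableSpace (Ω n)]
    (P : ∀ n, Measure (Ω n)) [∀ n, IsProbabilityMeasure (P n)]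
    (X Y : ∀ n, Ω n → Fin n → Fin n)
    (hX : ∀ n, 2 ≤ n → HasLaw (X n) (uniformOn (kemenyPopulation n)) (P n))
    (hY : ∀ n, 2 ≤ n → HasLaw (Y n) (uniformOn (kemenyPopulation n)) (P n))
    (hXY : ∀ n, 2 ≤ n → IndepFun (X n) (Y n) (P n))
    (D : ∀ n, Ω n → ℝ) (hD : ∀ n ω, D n ω = kemenyDist (X n ω) (Y n ω))
    {m σ : ℕ → ℝ} (hm : ∀ n, 2 ≤ n → m n = ((n : ℝ) ^ 2 - n) / 2)
    (hσ : Tendsto (fun n : ℕ => σ n ^ 2 / (n : ℝ) ^ 3) atTop (𝓝 (1 / 9))) :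
    TendstoInDistribution (fun n ω => (D n ω - m n) / σ n) atTop (id : ℝ → ℝ) P
      (gaussianReal 0 1) := by
  have hmeas : ∀ n, AEMeasurable (fun ω => (D n ω - m n) / σ n) (P n) := fun n =>
    ((aemeasurable_kemenyDist (aemeasurable_of_hasLaw_kemenyPopulation (hX n))
      (aemeasurable_of_hasLaw_kemenyPopulation (hY n)) (hD n)).sub_const _).div_const _
  refine ⟨hmeas, aemeasurable_id, ?_⟩
  refine ProbabilityMeasure.tendsto_iff_tendsto_charFun.2 fun t => ?_
  have hlim : charFun ((gaussianReal 0 1).map (id : ℝ → ℝ)) t = Complex.exp (-(t : ℂ) ^ 2 / 2) := by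
    rw [Measure.map_id, charFun_gaussianReal]
    congr 1
    push_cast
    ring
  have hρ : Tendsto (fun n => (((nonconstFraction n ^ 2)⁻¹ : ℝ) : ℂ)) atTop (𝓝 1) := by
    have h := (tendsto_nonconstFraction.pow 2).inv₀ (by norm_num)
    rw [one_pow, inv_one] at h
    have h' := (Complex.continuous_ofReal.tendsto _).comp h
    rw [Complex.ofReal_one] at h'
    exact h'
  -- The exponential is 1 at 0, so the characteristic function is 1 + p⁻²(E₀ - 1), and p → 1 removes
  -- the conditioning.
  have h := (hρ.mul ((tendsto_expect_exp_concordance hσ t).sub_const 1)).const_add 1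
  rw [one_mul, add_sub_cancel, ← hlim] at h
  refine h.congr' ?_
  filter_upwards [eventually_ge_atTop 2] with n hn
  have hint := integral_comp_concordance_eq_expect (𝕜 := ℂ) hn (hX n hn) (hY n hn) (hXY n hn)
    fun τ => Complex.exp (Complex.I * ((-t / (2 * σ n) * τ : ℝ) : ℂ))
  have hchar : charFun ((P n).map fun ω => (D n ω - m n) / σ n) t =
      ∫ ω, Complex.exp (Complex.I *
        ((-t / (2 * σ n) * concordance (X n ω) (Y n ω) : ℝ) : ℂ)) ∂(P n) := by
    rw [charFun_apply_real, integral_map (hmeas n) (by fun_prop)]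
    refine integral_congr_ae (Eventually.of_forall fun ω => ?_)
    beta_reduce
    rw [hD, kemenyDist_eq, hm n hn, mul_comm Complex.I, ← Complex.ofReal_mul]
    congr 3
    rw [mul_comm 2 (σ n), ← div_div, div_mul_eq_mul_div, div_mul_eq_mul_div, ← mul_div_assoc]
    ring
  refine Eq.trans ?_ hchar.symm
  rw [hint]
  simp

end

theorem mainTheorem4 {Ω : ℕ → Type*} [∀ n, MeasurableSpace (Ω n)]
    (P : ∀ n, Measure (Ω n)) [∀ n, IsProbabilityMeasure (P n)]
    (X Y : ∀ n, Ω n → Fin n → Fin n)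
    (hX : ∀ n, 2 ≤ n → HasLaw (X n) (uniformOn (kemenyPopulation n)) (P n))
    (hY : ∀ n, 2 ≤ n → HasLaw (Y n) (uniformOn (kemenyPopulation n)) (P n))
    (hXY : ∀ n, 2 ≤ n → IndepFun (X n) (Y n) (P n))
    (D : ∀ n, Ω n → ℝ) (hD : ∀ n ω, D n ω = kemenyDist (X n ω) (Y n ω)) :
    -- the centring and scaling constants
    (∀ n, 2 ≤ n → ∫ ω, D n ω ∂(P n) = ((n : ℝ) ^ 2 - n) / 2 ∧ 0 < variance (D n) (P n)) ∧
    -- asymptotic normality, scaled by the exact standard deviation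
    TendstoInDistribution
      (fun n ω => (D n ω - ∫ ω', D n ω' ∂(P n)) / √(variance (D n) (P n)))
      atTop (id : ℝ → ℝ) P (gaussianReal 0 1) ∧
    -- asymptotic normality, scaled by the closed-form standard deviation
    TendstoInDistribution
      (fun n ω => (D n ω - ((n : ℝ) ^ 2 - n) / 2) / √(kemenyPopVariance n))
      atTop (id : ℝ → ℝ) P (gaussianReal 0 1) ∧
    -- the excess kurtosis is negative and increases to `0`
    (∀ n, 2 ≤ n → excessKurtosis (D n) (P n) < 0) ∧
    (∀ n, 2 ≤ n → excessKurtosis (D n) (P n) < excessKurtosis (D (n + 1)) (P (n + 1))) ∧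
    Tendsto (fun n => excessKurtosis (D n) (P n)) atTop (𝓝 0) := by
  have hmean : ∀ n, 2 ≤ n → ∫ ω, D n ω ∂(P n) = ((n : ℝ) ^ 2 - n) / 2 := fun n hn =>
    integral_kemenyDist hn (hX n hn) (hY n hn) (hXY n hn) (hD n)
  have hvar : ∀ n, 2 ≤ n → variance (D n) (P n) = concordanceVar n / nonconstFraction n ^ 2 :=
    fun n hn => variance_kemenyDist hn (hX n hn) (hY n hn) (hXY n hn) (hD n)
  have hkurt : ∀ n, 2 ≤ n → excessKurtosis (D n) (P n) = kemenyKurtosis n := fun n hn =>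
    excessKurtosis_kemenyDist hn (hX n hn) (hY n hn) (hXY n hn) (hD n)
  refine ⟨fun n hn => ⟨hmean n hn, ?_⟩, ?_, ?_, fun n hn => ?_, fun n hn => ?_, ?_⟩
  · rw [hvar n hn]
    exact div_pos (concordanceVar_pos hn) (pow_pos (nonconstFraction_pos hn) 2)
  · refine tendstoInDistribution_kemenyDist P X Y hX hY hXY D hD hmean ?_
    have h := tendsto_concordanceVar_div.div (tendsto_nonconstFraction.pow 2) (by norm_num)
    rw [one_pow, div_one] at h
    refine h.congr' ?_
    filter_upwards [eventually_ge_atTop 2] with n hn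
    rw [Real.sq_sqrt (variance_nonneg _ _), hvar n hn, Pi.div_apply, div_right_comm]
  · refine tendstoInDistribution_kemenyDist P X Y hX hY hXY D hD (fun n _ => rfl) ?_
    refine tendsto_kemenyPopVariance_div.congr' ?_
    filter_upwards [eventually_ge_atTop 2] with n hn
    have h : (2 : ℝ) ≤ n := by exact_mod_cast hn
    rw [Real.sq_sqrt]
    rw [kemenyPopVariance]
    exact div_nonneg (mul_nonneg (mul_nonneg (sq_nonneg _) (by linarith)) (by linarith))
      (by linarith)
  · rw [hkurt n hn]
    exact kemenyKurtosis_neg hn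
  · rw [hkurt n hn, hkurt (n + 1) (by omega)]
    exact kemenyKurtosis_lt_succ hn
  · refine tendsto_kemenyKurtosis.congr' ?_
    filter_upwards [eventually_ge_atTop 2] with n hn
    exact (hkurt n hn).symm
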